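/- **Setting.** Let $\Omega\subset\mathbb R^d$ be a bounded domain of class $C^1$, $\partial\Omega_1\subset\partial\Omega$ relatively open, and $B_\Omega(x_0,r)=B(x_0,r)\cap\overline\Omega$, where $B(x_0,r)$ is the open ball. Let $y\in C^1(\overline\Omega;\mathbb R^m)$ and $F(x)=\nabla y(x)$. Let $W:\overline\Omega\times\mathbb R^{m\times d}\to\mathbb R$ be continuous and such that, for some open set $\mathcal O\supset F(\overline\Omega)$, the functions $W$, $W_F$, $W_{FF}$ (derivatives in the matrix variable) exist and are continuous on $\overline\Omega\times\mathcal O$. Matrices carry the Frobenius inner product $(\cdot,\cdot)$ and norm $|\cdot|$. Put $$W^\circ(x,H)=W(x,F(x)+H)-W(x,F(x))-(W_F(x,F(x)),H),\qquad \mathsf L(x)=W_{FF}(x,F(x)),$$ $$U(x,H)=\frac{W^\circ(x,H)-\frac12(\mathsf L(x)H,H)}{|H|^2}\ (H\ne0),\quad U(x,0)=0,\qquad \mathcal F(x,\alpha,G)=\frac{W^\circ(x,\alpha G)}{\alpha^2}=U(x,\alpha G)|G|^2+\tfrac12(\mathsf L(x)G,G)\quad(\alpha>0).$$ Let $v_n\rightharpoonup0$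 weakly in $W^{1,2}(\Omega;\mathbb R^m)$ and let $\alpha_n>0$ be such that $\alpha_nv_n$ is bounded in $W^{1,\infty}(\Omega;\mathbb R^m)$; put $R=\sup_n\|\alpha_n\nabla v_n\|_\infty$. Let $\tilde M=\tilde\mu_x\otimes\tilde\pi$ and $\tilde\Lambda=\tilde\lambda_x\otimes\tilde\pi$ be the limit measures of the pair $(\alpha_n,v_n)$ (they exist after passing to a subsequence, not relabeled). That is, $\tilde\pi$ is a finite nonnegative Borel measure on $\overline\Omega$, and $\tilde\mu_x$, $\tilde\lambda_x$ are measurable families of probability measures on $\mathbb R^{m\times d}$, carried for $\tilde\pi$-a.e. $x$ by the closed ball $\overline{\mathcal B}(0,R)$ and by the unit sphere $\mathcal S$ respectively, such that $$\lim_{n\to\infty}\int_\Omega f(x,\alpha_n\nabla v_n)|\nabla v_n|^2\,dx=\int_{\overline\Omega}\int f(x,H)\,d\tilde\mu_x(H)\,d\tilde\pi(x)\quad\text{for all } f\in C(\overline\Omega\times\mathbb R^{m\times d}),$$ $$\lim_{n\to\infty}\int_\Omega f\Big(x,\frac{\nabla v_n}{|\nabla v_n|}\Big)|\nabla v_n|^2\,dx=\int_{\overline\Omega}\int_{\mathcal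 S} f(x,H)\,d\tilde\lambda_x(H)\,d\tilde\pi(x)\quad\text{for all } f\in C(\overline\Omega\times\mathcal S),$$ where the integrand on the left of the second line is $0$ where $\nabla v_n=0$. Put $$\mathcal I(x,\mu,\lambda)=\int_{\overline{\mathcal B}(0,R)}U(x,H)\,d\mu(H)+\frac12\int_{\mathcal S}(\mathsf L(x)H,H)\,d\lambda(H).$$ **Theorem 8.1 (localization principle in the interior).** For $\tilde\pi$-a.e. $x_0\in\Omega\cup\overline{\partial\Omega_1}$ the following holds. We have $\tilde\pi(B_\Omega(x_0,r))>0$ for all $r>0$. Let, for every $r>0$, cut-off functions $\theta_k^r\in C_0^\infty(B_\Omega(x_0,r))$, $k\ge0$, be given. Here $B_\Omega(x_0,r)$ is regarded as a relatively open subset of $\overline\Omega$, so that $\theta_k^r$ is the restriction to $\overline\Omega$ of a smooth function on $\mathbb R^d$ and vanishes on $\overline\Omega$ outside a compact subset of $B_\Omega(x_0,r)$, but need not vanish on $\partial\Omega$. Suppose that for each $r$ the functions $\theta_k^r$ are bounded uniformly in $k$ and $\theta_k^r(x)\to\chi_{B_\Omega(x_0,r)}(x)$ as $k\to\infty$ for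 every $x\in\overline\Omega$. Then all the limits below exist (those in $n$ and in $k$ for every $r>0$), and $$\lim_{r\to0}\lim_{k\to\infty}\lim_{n\to\infty}\frac1{\tilde\pi(B_\Omega(x_0,r))}\int_{B_\Omega(x_0,r)}\mathcal F\big(x_0,\alpha_n,\nabla(\theta_k^r(x)v_n(x))\big)\,dx=\mathcal I(x_0,\tilde\mu_{x_0},\tilde\lambda_{x_0}).$$ -/

import Mathlib

open Set Filter Topology MeasureTheory ProbabilityTheory
open scoped ENNReal NNReal ContDiff

noncomputable section

/-- Euclidean space `ℝ^d`. -/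
abbrev Vec (d : ℕ) : Type := EuclideanSpace ℝ (Fin d)

/-- Real `m × d` matrices with the Frobenius inner product and norm. -/
abbrev Mat (m d : ℕ) : Type := EuclideanSpace ℝ (Fin m × Fin d)

/-- A bounded domain of class `C¹`: nonempty, open, connected, bounded, and near every boundary
point it is the region strictly above the graph of a `C¹` function in some direction `e`. -/
structure IsC1Domain {d : ℕ} (Ω : Set (Vec d)) : Prop where
  isOpen : IsOpen Ω
  isConnected : IsConnected Ω
  isBounded : Bornology.IsBounded Ω
  boundary : ∀ x₀ ∈ frontier Ω, ∃ r : ℝ, 0 < r ∧ ∃ e : Vec d, ‖e‖ = 1 ∧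
    ∃ γ : Vec d → ℝ, ContDiff ℝ 1 γ ∧
      ∀ x ∈ Metric.ball x₀ r, (x ∈ Ω ↔ γ (x - (inner ℝ e x : ℝ) • e) < (inner ℝ e x : ℝ))

/-- `Γ` is a relatively open subset of the boundary of `Ω`. -/
def IsRelOpenInBoundary {d : ℕ} (Ω Γ : Set (Vec d)) : Prop :=
  ∃ V : Set (Vec d), IsOpen V ∧ Γ = V ∩ frontier Ω

/-- `B_Ω(x₀, r)`: the part of the open ball that lies in the closure of `Ω`. -/
def ballIn {d : ℕ} (Ω : Set (Vec d)) (x₀ : Vec d) (r : ℝ) : Set (Vec d) :=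
  Metric.ball x₀ r ∩ closure Ω

/-! ### Sobolev functions -/

/-- `G` is a weak gradient of `u` on `Ω`: `G_{ij} = ∂_j u_i` in the sense of distributions. -/
structure HasWeakGrad {d m : ℕ} (Ω : Set (Vec d)) (u : Vec d → Vec m) (G : Vec d → Mat m d) :
    Prop where
  locInt : LocallyIntegrableOn u Ω
  locInt_grad : LocallyIntegrableOn G Ω
  integral_eq : ∀ φ : Vec d → ℝ, ContDiff ℝ ∞ φ → HasCompactSupport φ → tsupport φ ⊆ Ω →
    ∀ (i : Fin m) (j : Fin d),
      ∫ x in Ω, u x i * fderiv ℝ φ x (EuclideanSpace.single j 1) = -∫ x in Ω, G x (i, j) * φ x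

open Classical in
/-- The weak gradient of `u` on `Ω` (unique up to null sets; `0` if there is none). -/
def weakGrad {d m : ℕ} (Ω : Set (Vec d)) (u : Vec d → Vec m) : Vec d → Mat m d :=
  if h : ∃ G, HasWeakGrad Ω u G then h.choose else 0

/-- `u ∈ W^{1,p}(Ω; ℝ^m)`. -/
def MemW1 {d m : ℕ} (Ω : Set (Vec d)) (p : ℝ≥0∞) (u : Vec d → Vec m) : Prop :=
  MemLp u p (volume.restrict Ω) ∧
    ∃ G : Vec d → Mat m d, HasWeakGrad Ω u G ∧ MemLp G p (volume.restrict Ω)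

/-- `v_n ⇀ 0` weakly in `W^{1,2}(Ω; ℝ^m)`. The continuous linear functionals on `W^{1,2}` are
exactly `v ↦ ∫_Ω (g, v) + ∫_Ω (G, ∇v)` with `g` and `G` square integrable. -/
def WeaklyNullW12 {d m : ℕ} (Ω : Set (Vec d)) (v : ℕ → Vec d → Vec m) : Prop :=
  (∀ n, MemW1 Ω 2 (v n)) ∧
    ∀ (g : Vec d → Vec m) (G : Vec d → Mat m d),
      MemLp g 2 (volume.restrict Ω) → MemLp G 2 (volume.restrict Ω) →
      Tendsto (fun n => (∫ x in Ω, (inner ℝ (g x) (v n x) : ℝ)) +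
        ∫ x in Ω, (inner ℝ (G x) (weakGrad Ω (v n) x) : ℝ)) atTop (𝓝 0)

/-- The sequence `w_n` is bounded in `W^{1,∞}(Ω; ℝ^m)`. -/
def BoundedW1Inf {d m : ℕ} (Ω : Set (Vec d)) (w : ℕ → Vec d → Vec m) : Prop :=
  ∃ C : ℝ≥0, ∀ n, MemW1 Ω ∞ (w n) ∧ eLpNorm (w n) ∞ (volume.restrict Ω) ≤ C ∧
    eLpNorm (weakGrad Ω (w n)) ∞ (volume.restrict Ω) ≤ C

/-! ### The Lagrangian and the reduced Lagrangian -/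

/-- `y ∈ C¹(closure Ω; ℝ^m)`, and `F` is its gradient, extended continuously to `closure Ω`. -/
structure IsC1WithGrad {d m : ℕ} (Ω : Set (Vec d)) (y : Vec d → Vec m) (F : Vec d → Mat m d) :
    Prop where
  continuousOn : ContinuousOn y (closure Ω)
  differentiableAt : ∀ x ∈ Ω, DifferentiableAt ℝ y x
  grad_eq : ∀ x ∈ Ω, ∀ (i : Fin m) (j : Fin d),
    F x (i, j) = fderiv ℝ y x (EuclideanSpace.single j 1) i
  continuousOn_grad : ContinuousOn F (closure Ω)

/-- The Lagrangian `W(x, H)` is continuous on `closure Ω × ℝ^{m×d}`, and it is `C²` in `H` on the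
range `{F(x) : x ∈ closure Ω}`: on `closure Ω × O`, with `O` an open neighbourhood of the range,
the derivatives `W_F` and `W_FF` exist and are continuous in `(x, H)`. -/
structure IsLagrangian {d m : ℕ} (Ω : Set (Vec d)) (F : Vec d → Mat m d)
    (W : Vec d → Mat m d → ℝ) : Prop where
  continuousOn : ContinuousOn (fun p : Vec d × Mat m d => W p.1 p.2) (closure Ω ×ˢ univ)
  c2 : ∃ O : Set (Mat m d), IsOpen O ∧ F '' closure Ω ⊆ O ∧
    (∀ x ∈ closure Ω, ContDiffOn ℝ 2 (W x) O) ∧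
    ContinuousOn (fun p : Vec d × Mat m d => fderiv ℝ (W p.1) p.2) (closure Ω ×ˢ O) ∧
    ContinuousOn (fun p : Vec d × Mat m d => fderiv ℝ (fderiv ℝ (W p.1)) p.2) (closure Ω ×ˢ O)

/-- `W°(x, H) = W(x, F(x) + H) - W(x, F(x)) - (W_F(x, F(x)), H)`. -/
def Wcirc {d m : ℕ} (W : Vec d → Mat m d → ℝ) (F : Vec d → Mat m d) (x : Vec d) (H : Mat m d) :
    ℝ :=
  W x (F x + H) - W x (F x) - fderiv ℝ (W x) (F x) H

/-- The quadratic form `(L(x) H, H)`, where `L(x) = W_FF(x, F(x))`. -/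
def quadL {d m : ℕ} (W : Vec d → Mat m d → ℝ) (F : Vec d → Mat m d) (x : Vec d) (H : Mat m d) :
    ℝ :=
  fderiv ℝ (fderiv ℝ (W x)) (F x) H H

/-- `U(x, H) = |H|⁻² (W°(x, H) - (L(x) H, H) / 2)`, with `U(x, 0) = 0`. -/
def Ufun {d m : ℕ} (W : Vec d → Mat m d → ℝ) (F : Vec d → Mat m d) (x : Vec d) (H : Mat m d) :
    ℝ :=
  (Wcirc W F x H - quadL W F x H / 2) / ‖H‖ ^ 2

/-- `𝓕(x, α, G) = W°(x, α G) / α²`. -/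
def scriptF {d m : ℕ} (W : Vec d → Mat m d → ℝ) (F : Vec d → Mat m d) (x : Vec d) (α : ℝ)
    (G : Mat m d) : ℝ :=
  Wcirc W F x (α • G) / α ^ 2

/-- `𝓘(x, μ, lam) = ∫ U(x, H) dμ(H) + (1/2) ∫ (L(x) H, H) dlam(H)`. It is used for `μ` carried by
a ball and `lam` carried by the unit sphere, so integrating over all matrices is the same as
integrating over the ball and over the sphere. -/
def scriptI {d m : ℕ} (W : Vec d → Mat m d → ℝ) (F : Vec d → Mat m d) (x : Vec d)
    (μ lam : Measure (Mat m d)) : ℝ :=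
  (∫ H, Ufun W F x H ∂μ) + (1 / 2) * ∫ H, quadL W F x H ∂lam

/-! ### The measures associated with a pair `(α_n, v_n)` -/

/-- `R = sup_n ‖α_n ∇v_n‖_∞`. -/
def gradBound {d m : ℕ} (Ω : Set (Vec d)) (α : ℕ → ℝ) (v : ℕ → Vec d → Vec m) : ℝ≥0∞ :=
  ⨆ n, eLpNorm (fun x => α n • weakGrad Ω (v n) x) ∞ (volume.restrict Ω)

/-- `M = μ_x ⊗ π` and `Λ = lam_x ⊗ π` are the limit measures of the pair `(α_n, v_n)`: `π` is a
finite measure on `closure Ω`, `μ_x` and `lam_x` are probability measures carried by the closed ball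
of radius `R` and by the unit sphere, `M` is the weak-* limit of the push-forwards of
`|∇v_n|² dx` under `x ↦ (x, α_n ∇v_n(x))`, and `Λ` that of the push-forwards of the same measures
under `x ↦ (x, ∇v_n(x) / |∇v_n(x)|)`. -/
structure IsLimitMeasures {d m : ℕ} (Ω : Set (Vec d)) (α : ℕ → ℝ) (v : ℕ → Vec d → Vec m)
    (π : Measure (Vec d)) (μ lam : Kernel (Vec d) (Mat m d)) : Prop where
  finite : IsFiniteMeasure π
  carrier : π (closure Ω)ᶜ = 0
  markov_mu : IsMarkovKernel μ
  markov_lam : IsMarkovKernel lam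
  carrier_mu : ∀ᵐ x ∂π, μ x {H | gradBound Ω α v < ‖H‖ₑ} = 0
  carrier_lam : ∀ᵐ x ∂π, lam x (Metric.sphere 0 1)ᶜ = 0
  tendsto_mu : ∀ f : Vec d × Mat m d → ℝ, ContinuousOn f (closure Ω ×ˢ univ) →
    Tendsto (fun n => ∫ x in Ω, f (x, α n • weakGrad Ω (v n) x) * ‖weakGrad Ω (v n) x‖ ^ 2)
      atTop (𝓝 (∫ p, f p ∂(π ⊗ₘ μ)))
  tendsto_lam : ∀ f : Vec d × Mat m d → ℝ, ContinuousOn f (closure Ω ×ˢ Metric.sphere 0 1) →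
    Tendsto (fun n => ∫ x in Ω, f (x, ‖weakGrad Ω (v n) x‖⁻¹ • weakGrad Ω (v n) x) *
        ‖weakGrad Ω (v n) x‖ ^ 2)
      atTop (𝓝 (∫ p, f p ∂(π ⊗ₘ lam)))

/-! ### Cut-off functions -/

/-- `θ_k ∈ C₀^∞(B_Ω(x₀, r))` converge pointwise on `closure Ω` to the characteristic function of
`B_Ω(x₀, r)` and are uniformly bounded. Here `B_Ω(x₀, r)` is regarded as a relatively open subset of
`closure Ω`: the `θ_k` are restrictions of smooth functions and vanish outside a compact
subset of `B_Ω(x₀, r)`, but need not vanish on the boundary of `Ω`. -/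
structure IsCutoffSeq {d : ℕ} (Ω : Set (Vec d)) (x₀ : Vec d) (r : ℝ) (θ : ℕ → Vec d → ℝ) :
    Prop where
  smooth : ∀ k, ContDiff ℝ ∞ (θ k)
  support : ∀ k, ∃ K : Set (Vec d), IsCompact K ∧ K ⊆ ballIn Ω x₀ r ∧
    ∀ x ∈ closure Ω, x ∉ K → θ k x = 0
  bounded : ∃ C : ℝ, ∀ k, ∀ x ∈ closure Ω, |θ k x| ≤ C
  tendsto : ∀ x ∈ closure Ω,
    Tendsto (fun k => θ k x) atTop (𝓝 ((ballIn Ω x₀ r).indicator 1 x))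

/-- `(1 / π(B_Ω(x₀, r))) ∫_{B_Ω(x₀, r)} 𝓕(x₀, α, ∇(θ v)) dx`, the integral being with respect to
Lebesgue measure on `Ω`, where `v` is defined. -/
def localAverage {d m : ℕ} (Ω : Set (Vec d)) (W : Vec d → Mat m d → ℝ) (F : Vec d → Mat m d)
    (π : Measure (Vec d)) (x₀ : Vec d) (r : ℝ) (θ : Vec d → ℝ) (α : ℝ) (v : Vec d → Vec m) : ℝ :=
  1 / (π (ballIn Ω x₀ r)).toReal *
    ∫ x in ballIn Ω x₀ r, scriptF W F x₀ α (weakGrad Ω (fun z => θ z • v z) x)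
      ∂(volume.restrict Ω)

end

/-! For a fixed cut-off `θ`, the product rule gives ∇(θ v_n) = θ ∇v_n + v_n ⊗ ∇θ. By Rellich's
theorem v_n → 0 strongly in L², so the second term is negligible in L², while both terms stay
bounded in L^∞ after multiplication by α_n. The energy density is U(x₀, αG)|G|² + (L(x₀)G, G)/2 with
U(x₀, ·) continuous (`IsLagrangian.continuous_Ufun`, a Taylor expansion at F(x₀)), so a strongly
vanishing perturbation of the gradients does not change the limit (`tendsto_integral_energy_sub`).

What remains is θ ∇v_n. Its U-part is the test function θ(x)² U(x₀, θ(x)H) evaluated along α_n ∇v_n,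
which converges to an integral against μ_x ⊗ π. The quadratic part depends only on the direction of
∇v_n once |∇v_n|² is factored out, so it converges to an integral against lam_x ⊗ π
(`tendsto_setIntegral_scriptF`). The limit in k is dominated convergence, since the limit measures
have bounded support (`tendsto_integral_cutoff`), and leaves π-averages over B_Ω(x₀, r) of x ↦ ∫
U(x₀, H) dμ_x and of its quadratic analogue.

The limit r → 0 is Lebesgue differentiation with respect to π. The integrand U(x₀, ·) itself depends
on x₀, so one null set must serve all continuous integrands; separability of the space of continuous
functions provides it (`ae_forall_tendsto_average_kernel`).

Rellich's theorem is proved from translation estimates: near each point of the closure, u is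
L²-close to its averages over x + S for a small open set S of admissible directions, and these
averages tend to zero pointwise and boundedly by weak convergence. -/

noncomputable section

/-! ### Rellich compactness by translation estimates -/

section Compactness

variable {E : Type*} [NormedAddCommGroup E] [InnerProductSpace ℝ E] [FiniteDimensional ℝ E]
  [MeasurableSpace E] [BorelSpace E]

/-- The distributional gradient of `u` on `Ω` has `L²` norm at most `N`, expressed by duality. -/
def DerivBound (Ω : Set E) (u : E → ℝ) (N : ℝ) : Prop :=
  ∀ ψ : E → ℝ, ContDiff ℝ ∞ ψ → HasCompactSupport ψ → tsupport ψ ⊆ Ω → ∀ z : E,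
    |∫ x, u x * fderiv ℝ ψ x z| ≤ N * ‖z‖ * √(∫ x, ψ x ^ 2)

/-- The translation is moved onto the test function: s ↦ ∫ u(x) ψ(x - s z) dx has derivative
controlled by `DerivBound` applied to the translate of ψ, and the mean value inequality on [0, 1]
concludes. The segment condition keeps the supports of all translates inside Ω. -/
lemma DerivBound.abs_integral_translate_le {Ω A : Set E} {u : E → ℝ} {N : ℝ}
    (h : DerivBound Ω u N) (hu : Integrable u) {z : E}
    (hz : ∀ x ∈ A, ∀ s ∈ Icc (0 : ℝ) 1, x + s • z ∈ Ω) {ψ : E → ℝ} (hψ : ContDiff ℝ ∞ ψ)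
    (hψc : HasCompactSupport ψ) (hψA : tsupport ψ ⊆ A) :
    |∫ x, (u (x + z) - u x) * ψ x| ≤ N * ‖z‖ * √(∫ x, ψ x ^ 2) := by
  have hψ1 : ContDiff ℝ 1 ψ := hψ.of_le (by exact_mod_cast le_top)
  have hdcont : Continuous (fderiv ℝ ψ) := hψ1.continuous_fderiv (by norm_num)
  obtain ⟨C, hC⟩ := (hψc.fderiv (𝕜 := ℝ)).exists_bound_of_continuous hdcont
  obtain ⟨C0, hC0⟩ := hψc.exists_bound_of_continuous hψ.continuous
  set g : ℝ → ℝ := fun s => ∫ x, u x * ψ (x - s • z) with hg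
  have hint : ∀ s : ℝ, Integrable (fun x => u x * ψ (x - s • z)) := fun s =>
    hu.mul_bdd (hψ.continuous.comp (by fun_prop : Continuous fun x : E => x - s • z)).aestronglyMeasurable
      (Eventually.of_forall fun x => hC0 _)
  have hder : ∀ s : ℝ, HasDerivAt g (∫ x, u x * (-(fderiv ℝ ψ (x - s • z) z))) s := by
    intro s
    refine (hasDerivAt_integral_of_dominated_loc_of_deriv_le (s := univ)
      (F := fun s x => u x * ψ (x - s • z))
      (F' := fun s x => u x * (-(fderiv ℝ ψ (x - s • z) z)))
      (bound := fun x => ‖u x‖ * (C * ‖z‖)) univ_mem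
      (Eventually.of_forall fun s => (hint s).aestronglyMeasurable) (hint s) ?_ ?_ ?_ ?_).2
    · refine hu.aestronglyMeasurable.mul (Continuous.aestronglyMeasurable ?_)
      exact ((hdcont.comp (by fun_prop : Continuous fun x : E => x - s • z)).clm_apply
        continuous_const).neg
    · refine Eventually.of_forall fun x t _ => ?_
      rw [norm_mul, norm_neg]
      gcongr
      exact ((fderiv ℝ ψ (x - t • z)).le_opNorm z).trans (by gcongr; exact hC _)
    · exact hu.norm.mul_const _
    · refine Eventually.of_forall fun x t _ => ?_
      have h1 : HasDerivAt (fun t : ℝ => x - t • z) (-z) t := by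
        simpa using ((hasDerivAt_id t).smul_const z).const_sub x
      have h2 := ((hψ1.differentiable (by norm_num)) (x - t • z)).hasFDerivAt.comp_hasDerivAt t h1
      simpa using h2.const_mul (u x)
  have hbd : ∀ s ∈ Icc (0 : ℝ) 1,
      ‖∫ x, u x * (-(fderiv ℝ ψ (x - s • z) z))‖ ≤ N * ‖z‖ * √(∫ x, ψ x ^ 2) := by
    intro s hs
    have hsh : HasCompactSupport fun x => ψ (x - s • z) := by
      have := hψc.comp_homeomorph (Homeomorph.subRight (s • z))
      simpa [Function.comp_def] using this
    have hts : tsupport (fun x => ψ (x - s • z)) ⊆ Ω := by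
      intro x hx
      have hx' : x - s • z ∈ tsupport ψ :=
        tsupport_comp_subset_preimage ψ (f := fun x => x - s • z) (by fun_prop) hx
      simpa using hz _ (hψA hx') s hs
    have := h (fun x => ψ (x - s • z)) (hψ.comp (by fun_prop)) hsh hts z
    rw [integral_sub_right_eq_self (fun x => ψ x ^ 2) (s • z)] at this
    simp_rw [fderiv_comp_sub] at this
    simpa [integral_neg] using this
  have hmv := Convex.norm_image_sub_le_of_norm_hasDerivWithin_le (s := Icc (0 : ℝ) 1)
    (fun s _ => (hder s).hasDerivWithinAt) hbd (convex_Icc 0 1) (x := 0) (y := 1)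
    (by simp) (by simp)
  have hfin : g 1 - g 0 = ∫ x, (u (x + z) - u x) * ψ x := by
    have e1 : g 1 = ∫ x, u (x + z) * ψ x := by
      simp only [hg, one_smul]
      rw [← integral_add_right_eq_self _ z]
      simp
    have e0 : g 0 = ∫ x, u x * ψ x := by simp [hg]
    rw [e1, e0, ← integral_sub]
    · simp only [sub_mul]
    · simpa using (hint 1).comp_add_right z
    · simpa using hint 0
  simpa [hfin] using hmv

/-- Smooth functions with compact support in an open set `A` determine the `L²` norm on `A`. -/
lemma setIntegral_sq_le_of_test {A : Set E} (hA : IsOpen A) {f : E → ℝ} (hf : MemLp f 2) {C : ℝ}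
    (hC : 0 ≤ C)
    (h : ∀ ψ : E → ℝ, ContDiff ℝ ∞ ψ → HasCompactSupport ψ → tsupport ψ ⊆ A →
      |∫ x, f x * ψ x| ≤ C * √(∫ x, ψ x ^ 2)) :
    ∫ x in A, f x ^ 2 ≤ C ^ 2 := by
  set ν : Measure E := volume.restrict A with hν
  have hout : ∀ {ψ : E → ℝ}, tsupport ψ ⊆ A → ∀ x, x ∉ A → ψ x = 0 := fun hψ x hx =>
    image_eq_zero_of_notMem_tsupport fun hx' => hx (hψ hx')
  let V : Submodule ℝ (Lp ℝ 2 ν) :=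
    { carrier := {φ | ∃ ψ : E → ℝ, ContDiff ℝ ∞ ψ ∧ HasCompactSupport ψ ∧ tsupport ψ ⊆ A ∧
        φ =ᵐ[ν] ψ}
      add_mem' := by
        rintro a b ⟨ψ, h1, h2, h3, h4⟩ ⟨ψ', h1', h2', h3', h4'⟩
        refine ⟨ψ + ψ', h1.add h1', h2.add h2', ?_, ?_⟩
        · exact (tsupport_add ψ ψ').trans (union_subset h3 h3')
        · filter_upwards [Lp.coeFn_add a b, h4, h4'] with x hx h4 h4'
          exact hx.trans (by simp [h4, h4'])
      zero_mem' := ⟨0, contDiff_const, HasCompactSupport.zero, by simp [tsupport], Lp.coeFn_zero _ _ _⟩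
      smul_mem' := by
        rintro c a ⟨ψ, h1, h2, h3, h4⟩
        refine ⟨c • ψ, contDiff_const.smul h1, h2.smul_left (f := fun _ => c), ?_, ?_⟩
        · exact (tsupport_smul_subset_right (fun _ => c) ψ).trans h3
        · filter_upwards [Lp.coeFn_smul c a, h4] with x hx h4
          exact hx.trans (by simp [h4]) }
  have hinner : ∀ a b : Lp ℝ 2 ν, inner ℝ a b = ∫ x, a x * b x ∂ν := by
    intro a b
    rw [L2.inner_def]
    simp [mul_comm]
  -- A function orthogonal to all test functions vanishes a.e. on `A`, so test functions are dense
  -- in L²(A).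
  have hdense : V.topologicalClosure = ⊤ := by
    rw [Submodule.topologicalClosure_eq_top_iff, Submodule.eq_bot_iff]
    intro w hw
    have hloc : LocallyIntegrableOn w A ν :=
      ((Lp.memLp w).locallyIntegrable (by norm_num)).locallyIntegrableOn A
    have := hA.ae_eq_zero_of_integral_contDiff_smul_eq_zero hloc (fun ψ h1 h2 h3 => by
      have hm : MemLp ψ 2 ν := (h1.continuous.memLp_of_hasCompactSupport h2)
      have h0 := (Submodule.mem_orthogonal V w).1 hw (hm.toLp ψ) ⟨ψ, h1, h2, h3, hm.coeFn_toLp⟩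
      rw [hinner] at h0
      rw [← h0]
      refine integral_congr_ae ?_
      filter_upwards [hm.coeFn_toLp] with x hx
      simp [hx])
    refine (Lp.eq_zero_iff_ae_eq_zero).2 ?_
    filter_upwards [this, ae_restrict_mem hA.measurableSet] with x hx hxA using hx hxA
  have hfν : MemLp f 2 ν := hf.restrict A
  set F : Lp ℝ 2 ν := hfν.toLp f with hF
  have key : ∀ φ : Lp ℝ 2 ν, |inner ℝ F φ| ≤ C * ‖φ‖ := by
    intro φ
    have hcl : IsClosed {φ : Lp ℝ 2 ν | |inner ℝ F φ| ≤ C * ‖φ‖} :=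
      isClosed_le (by fun_prop) (by fun_prop)
    have hsub : (V.topologicalClosure : Set (Lp ℝ 2 ν)) ⊆ {φ | |inner ℝ F φ| ≤ C * ‖φ‖} := by
      rw [Submodule.topologicalClosure_coe]
      refine closure_minimal ?_ hcl
      rintro φ ⟨ψ, h1, h2, h3, h4⟩
      have e1 : inner ℝ F φ = ∫ x, f x * ψ x := by
        rw [hinner]
        have : ∫ x, F x * φ x ∂ν = ∫ x, f x * ψ x ∂ν := by
          refine integral_congr_ae ?_
          filter_upwards [hfν.coeFn_toLp, h4] with x hx hx'
          simp [hF, hx, hx']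
        rw [this]
        exact setIntegral_eq_integral_of_forall_compl_eq_zero fun x hx => by simp [hout h3 x hx]
      have e2 : ‖φ‖ = √(∫ x, ψ x ^ 2) := by
        rw [norm_eq_sqrt_real_inner φ, hinner]
        congr 1
        have : ∫ x, φ x * φ x ∂ν = ∫ x, ψ x ^ 2 ∂ν := by
          refine integral_congr_ae ?_
          filter_upwards [h4] with x hx'
          simp [hx', sq]
        rw [this]
        exact setIntegral_eq_integral_of_forall_compl_eq_zero fun x hx => by simp [hout h3 x hx]
      simp only [mem_ofPred_eq, e1, e2]
      exact h ψ h1 h2 h3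
    exact hsub (by rw [hdense]; trivial)
  -- Taking φ = F in the bound extended by density gives ‖F‖² ≤ C‖F‖.
  have hFn : ‖F‖ ≤ C := by
    have := key F
    rw [real_inner_self_eq_norm_sq, abs_of_nonneg (by positivity)] at this
    by_contra! hlt
    nlinarith [norm_nonneg F]
  have e3 : ∫ x in A, f x ^ 2 = ‖F‖ ^ 2 := by
    rw [← real_inner_self_eq_norm_sq, hinner]
    refine integral_congr_ae ?_
    filter_upwards [hfν.coeFn_toLp] with x hx
    simp [hF, hx, sq]
  rw [e3]
  gcongr

lemma DerivBound.lintegral_translate_le {Ω A : Set E} (hA : IsOpen A) {u : E → ℝ} {N : ℝ}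
    (hN : 0 ≤ N) (h : DerivBound Ω u N) (hu : Integrable u) (hu2 : MemLp u 2) {z : E}
    (hz : ∀ x ∈ A, ∀ s ∈ Icc (0 : ℝ) 1, x + s • z ∈ Ω) :
    ∫⁻ x in A, ENNReal.ofReal ((u x - u (x + z)) ^ 2) ≤ ENNReal.ofReal ((N * ‖z‖) ^ 2) := by
  have hm : MemLp (fun x => u (x + z) - u x) 2 :=
    (hu2.comp_measurePreserving (measurePreserving_add_right volume z)).sub hu2
  have := setIntegral_sq_le_of_test hA hm (C := N * ‖z‖) (by positivity)
    (fun ψ h1 h2 h3 => h.abs_integral_translate_le hu hz h1 h2 h3)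
  have hi : Integrable (fun x => (u x - u (x + z)) ^ 2) (volume.restrict A) := by
    have := (hm.integrable_sq).restrict (s := A)
    exact this.congr (Eventually.of_forall fun x => by simp only []; ring)
  rw [← ofReal_integral_eq_lintegral_ofReal hi (Eventually.of_forall fun x => sq_nonneg _)]
  refine ENNReal.ofReal_le_ofReal (le_trans (le_of_eq ?_) this)
  congr 1; ext x; ring

/-- If `Ω` contains the segments `[x, x + z]` for `x ∈ A` and all `z` in an open set `S` of vectors
of length at most `δ`, then `u` is `L²`-close on `A` to its averages over the sets `x + S`. -/
lemma DerivBound.lintegral_sq_le {Ω A S : Set E} (hA : IsOpen A) (hS : IsOpen S)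
    (hSne : S.Nonempty) {δ : ℝ} (hSδ : S ⊆ Metric.ball 0 δ) {u : E → ℝ} {N : ℝ}
    (hN : 0 ≤ N) (h : DerivBound Ω u N) (hum : Measurable u) (hu : Integrable u) (hu2 : MemLp u 2)
    (hz : ∀ z ∈ S, ∀ x ∈ A, ∀ s ∈ Icc (0 : ℝ) 1, x + s • z ∈ Ω) :
    ∫⁻ x in A, ENNReal.ofReal (u x ^ 2) ≤ 2 * ENNReal.ofReal ((N * δ) ^ 2) +
      2 * ∫⁻ x in A, ENNReal.ofReal ((⨍ z in S, u (x + z)) ^ 2) := by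
  have hS0 : volume S ≠ 0 := (hS.measure_pos volume hSne).ne'
  have hSt : volume S ≠ ⊤ := (measure_mono hSδ).trans_lt Metric.isBounded_ball.measure_lt_top |>.ne
  have hSr : 0 < volume.real S := ENNReal.toReal_pos hS0 hSt
  have hut : ∀ x, MemLp (fun z => u (x + z)) 2 := fun x =>
    hu2.comp_measurePreserving (measurePreserving_add_left volume x)
  have : IsFiniteMeasure (volume.restrict S) := ⟨by simpa using hSt.lt_top⟩
  -- Pointwise, u² ≤ 2(u - a)² + 2a² with a the average over x + S, and (u - a)² is at most the
  -- average of (u(x) - u(x + z))².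
  have pt : ∀ x, ENNReal.ofReal (u x ^ 2) ≤
      2 * (volume S)⁻¹ * (∫⁻ z in S, ENNReal.ofReal ((u x - u (x + z)) ^ 2)) +
      2 * ENNReal.ofReal ((⨍ z in S, u (x + z)) ^ 2) := by
    intro x
    set a := ⨍ z in S, u (x + z) with ha
    have m2 : MemLp (fun z => u x - u (x + z)) 2 (volume.restrict S) :=
      (memLp_const (u x)).sub ((hut x).restrict S)
    have i1 : Integrable (fun z => (u x - u (x + z)) ^ 2) (volume.restrict S) := m2.integrable_sq
    have hreal : u x ^ 2 ≤ 2 * (volume.real S)⁻¹ * (∫ z in S, (u x - u (x + z)) ^ 2) + 2 * a ^ 2 := by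
      have hav : ∫ z in S, (u x - u (x + z)) = volume.real S * (u x - a) := by
        rw [integral_sub (integrable_const _) (((hut x).restrict S).integrable (by norm_num))]
        simp only [integral_const, smul_eq_mul, ha, setAverage_eq]
        rw [measureReal_restrict_apply_univ]
        field_simp
      have i0 : Integrable (fun z => (u x - u (x + z))) (volume.restrict S) :=
        m2.integrable (by norm_num)
      -- Jensen's inequality, obtained by expanding a nonnegative variance.
      have : 0 ≤ ∫ z in S, ((u x - u (x + z)) - (u x - a)) ^ 2 :=
        integral_nonneg fun z => sq_nonneg _
      have e : ∫ z in S, ((u x - u (x + z)) - (u x - a)) ^ 2 =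
          (∫ z in S, (u x - u (x + z)) ^ 2) - volume.real S * (u x - a) ^ 2 := by
        have : ∀ z, ((u x - u (x + z)) - (u x - a)) ^ 2 = (u x - u (x + z)) ^ 2 -
            2 * (u x - a) * (u x - u (x + z)) + (u x - a) ^ 2 := fun z => by ring
        simp_rw [this]
        have i3 : Integrable (fun z => (u x - u (x + z)) ^ 2 - 2 * (u x - a) * (u x - u (x + z)))
          (volume.restrict S) := i1.sub (i0.const_mul _)
        rw [integral_add i3 (integrable_const _), integral_sub i1 (i0.const_mul _), integral_const_mul, hav]
        simp only [integral_const, smul_eq_mul]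
        rw [measureReal_restrict_apply_univ]
        ring
      rw [e] at this
      have h3 : (u x - a) ^ 2 ≤ (volume.real S)⁻¹ * ∫ z in S, (u x - u (x + z)) ^ 2 := by
        rw [le_inv_mul_iff₀ hSr]; linarith
      nlinarith [sq_nonneg (u x - 2 * a)]
    have h0 : 0 ≤ ∫ z in S, (u x - u (x + z)) ^ 2 := integral_nonneg fun z => sq_nonneg _
    refine (ENNReal.ofReal_le_ofReal hreal).trans (le_of_eq ?_)
    rw [ENNReal.ofReal_add (by positivity) (by positivity), ENNReal.ofReal_mul (by positivity),
      ENNReal.ofReal_mul (by positivity), ENNReal.ofReal_mul (by positivity),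
      ENNReal.ofReal_inv_of_pos hSr, measureReal_def, ENNReal.ofReal_toReal hSt,
      ofReal_integral_eq_lintegral_ofReal i1 (Eventually.of_forall fun z => sq_nonneg _)]
    simp
  have hmeas : Measurable fun p : E × E => ENNReal.ofReal ((u p.1 - u (p.1 + p.2)) ^ 2) := by
    fun_prop
  calc ∫⁻ x in A, ENNReal.ofReal (u x ^ 2)
      ≤ ∫⁻ x in A, (2 * (volume S)⁻¹ * (∫⁻ z in S, ENNReal.ofReal ((u x - u (x + z)) ^ 2)) +
      2 * ENNReal.ofReal ((⨍ z in S, u (x + z)) ^ 2)) := lintegral_mono fun x => pt x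
    _ = 2 * (volume S)⁻¹ * (∫⁻ x in A, ∫⁻ z in S, ENNReal.ofReal ((u x - u (x + z)) ^ 2)) +
      2 * ∫⁻ x in A, ENNReal.ofReal ((⨍ z in S, u (x + z)) ^ 2) := by
        have hm : Measurable fun x => ∫⁻ z in S, ENNReal.ofReal ((u x - u (x + z)) ^ 2) :=
          hmeas.lintegral_prod_right'
        rw [lintegral_add_left (hm.const_mul _), lintegral_const_mul _ hm,
          lintegral_const_mul' _ _ (by norm_num)]
    _ ≤ _ := by
        refine add_le_add ?_ le_rfl
        -- After exchanging the integrals, the translation estimate applies for each fixed z ∈ S,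
        -- with ‖z‖ < δ.
        rw [lintegral_lintegral_swap hmeas.aemeasurable]
        have : ∫⁻ z in S, ∫⁻ x in A, ENNReal.ofReal ((u x - u (x + z)) ^ 2) ≤
            ∫⁻ z in S, ENNReal.ofReal ((N * δ) ^ 2) := by
          refine setLIntegral_mono' hS.measurableSet fun z hzS => ?_
          refine (h.lintegral_translate_le hA hN hu hu2 (hz z hzS)).trans ?_
          have := mem_ball_zero_iff.1 (hSδ hzS)
          gcongr
        rw [setLIntegral_const] at this
        calc _ ≤ 2 * (volume S)⁻¹ * (ENNReal.ofReal ((N * δ) ^ 2) * volume S) := by gcongr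
          _ = 2 * ENNReal.ofReal ((N * δ) ^ 2) * ((volume S)⁻¹ * volume S) := by ring
          _ = _ := by rw [ENNReal.inv_mul_cancel hS0 hSt, mul_one]

/-- Near every point of the closure, `Ω` contains short segments in an open set of directions. -/
def HasOpenSegments (Ω : Set E) : Prop :=
  ∀ x₀ ∈ closure Ω, ∃ r > 0, ∀ δ > 0, ∃ S : Set E, IsOpen S ∧ S.Nonempty ∧ S ⊆ Metric.ball 0 δ ∧
    ∀ z ∈ S, ∀ x ∈ Ω ∩ Metric.ball x₀ r, ∀ s ∈ Icc (0 : ℝ) 1, x + s • z ∈ Ω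

/-- **Rellich's theorem**: weak convergence to zero with bounded gradients implies strong
convergence in `L²`. -/
theorem tendsto_lintegral_sq_of_weaklyNull {Ω : Set E} (hΩ : IsOpen Ω)
    (hb : Bornology.IsBounded Ω) (hseg : HasOpenSegments Ω) {u : ℕ → E → ℝ} {N M : ℝ} (hN : 0 ≤ N)
    (h : ∀ n, DerivBound Ω (u n) N) (hum : ∀ n, Measurable (u n)) (hu : ∀ n, Integrable (u n))
    (hu2 : ∀ n, MemLp (u n) 2) (hM : ∀ n, ∫ x, u n x ^ 2 ≤ M)
    (hw : ∀ g : E → ℝ, MemLp g 2 → Tendsto (fun n => ∫ x, g x * u n x) atTop (𝓝 0)) :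
    Tendsto (fun n => ∫⁻ x in Ω, ENNReal.ofReal (u n x ^ 2)) atTop (𝓝 0) := by
  have hcomp : IsCompact (closure Ω) := hb.isCompact_closure
  suffices H : Tendsto (fun n => ∫⁻ x in Ω ∩ closure Ω, ENNReal.ofReal (u n x ^ 2)) atTop (𝓝 0) by
    rwa [inter_eq_left.2 subset_closure] at H
  -- The convergence passes to subsets and finite unions, so by compactness it need only be shown
  -- near each point of the closure.
  refine hcomp.induction_on (p := fun s =>
    Tendsto (fun n => ∫⁻ x in Ω ∩ s, ENNReal.ofReal (u n x ^ 2)) atTop (𝓝 0)) ?_ ?_ ?_ ?_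
  · simp
  · intro s t hst ht
    exact tendsto_of_tendsto_of_tendsto_of_le_of_le tendsto_const_nhds ht (fun n => zero_le)
      fun n => lintegral_mono_set (inter_subset_inter_right _ hst)
  · intro s t hs ht
    refine tendsto_of_tendsto_of_tendsto_of_le_of_le tendsto_const_nhds
      (by simpa using hs.add ht) (fun n => zero_le) fun n => ?_
    rw [inter_union_distrib_left]
    exact lintegral_union_le _ _ _
  intro x₀ hx₀
  obtain ⟨r, hr, hseg⟩ := hseg x₀ hx₀
  refine ⟨Metric.ball x₀ r, mem_nhdsWithin_of_mem_nhds (Metric.ball_mem_nhds x₀ hr), ?_⟩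
  set A := Ω ∩ Metric.ball x₀ r with hAdef
  have hA : IsOpen A := hΩ.inter Metric.isOpen_ball
  have hAt : volume A ≠ ⊤ :=
    ((measure_mono inter_subset_left).trans_lt hb.measure_lt_top).ne
  rw [ENNReal.tendsto_nhds_zero]
  intro ε hε
  obtain ⟨δ, hδ, hδε⟩ : ∃ δ > 0, 2 * ENNReal.ofReal ((N * δ) ^ 2) ≤ ε / 2 := by
    have : Tendsto (fun δ : ℝ => 2 * ENNReal.ofReal ((N * δ) ^ 2)) (𝓝[>] 0) (𝓝 0) := by
      have : Tendsto (fun δ : ℝ => ENNReal.ofReal ((N * δ) ^ 2)) (𝓝 0) (𝓝 0) := by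
        have := (ENNReal.continuous_ofReal.comp
          (by fun_prop : Continuous fun δ : ℝ => (N * δ) ^ 2)).tendsto 0
        simpa [Function.comp_def] using this
      simpa using (ENNReal.Tendsto.const_mul (this.mono_left nhdsWithin_le_nhds)
        (Or.inr (by norm_num : (2 : ℝ≥0∞) ≠ ⊤)))
    have h2 := (ENNReal.tendsto_nhds_zero.1 this (ε / 2) (ENNReal.half_pos hε.ne'))
    obtain ⟨δ, h1, h2⟩ := (h2.and self_mem_nhdsWithin).exists
    exact ⟨δ, h2, h1⟩
  obtain ⟨S, hS, hSne, hSδ, hz⟩ := hseg δ hδ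
  have hS0 : volume S ≠ 0 := (hS.measure_pos volume hSne).ne'
  have hSt : volume S ≠ ⊤ := (measure_mono hSδ).trans_lt Metric.isBounded_ball.measure_lt_top |>.ne
  have hSr : 0 < volume.real S := ENNReal.toReal_pos hS0 hSt
  have hind : MemLp (S.indicator (fun _ => (1 : ℝ))) 2 :=
    memLp_indicator_const 2 hS.measurableSet 1 (Or.inr hSt)
  have hindx : ∀ x : E, MemLp (fun w => S.indicator (fun _ => (1 : ℝ)) (w - x)) 2 := fun x =>
    hind.comp_measurePreserving (measurePreserving_sub_right volume x)
  -- The average over x + S is a pairing of `u n` with an indicator, so it tends to zero by weak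
  -- convergence.
  have hav : ∀ n x, ⨍ z in S, u n (x + z) = (volume.real S)⁻¹ *
      ∫ w, S.indicator (fun _ => (1 : ℝ)) (w - x) * u n w := by
    intro n x
    rw [setAverage_eq, smul_eq_mul, ← integral_indicator hS.measurableSet,
      ← integral_add_left_eq_self (fun w => S.indicator (fun _ => (1 : ℝ)) (w - x) * u n w) x]
    congr 2; ext z
    by_cases hzS : z ∈ S <;> simp [hzS]
  -- A bound uniform in n and x, for dominated convergence: expand ∫ (u_n - aχ)² ≥ 0, where χ is the
  -- indicator of x + S.
  have hbd : ∀ n x, (⨍ z in S, u n (x + z)) ^ 2 ≤ (volume.real S)⁻¹ * M := by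
    intro n x
    set a := ⨍ z in S, u n (x + z) with ha
    set χ : E → ℝ := fun w => S.indicator (fun _ => (1 : ℝ)) (w - x) with hχ
    have i1 : Integrable (fun w => χ w * u n w) := (hindx x).integrable_mul (hu2 n)
    have i2 : Integrable χ := by
      have := (hindx x).integrable_sq
      refine this.congr (Eventually.of_forall fun w => ?_)
      by_cases hw : w - x ∈ S <;> simp [hχ, hw]
    have e2 : ∫ w, χ w = volume.real S := by
      rw [hχ, integral_sub_right_eq_self (fun w => S.indicator (fun _ => (1 : ℝ)) w) x,
        integral_indicator_const _ hS.measurableSet]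
      simp
    have e1 : ∫ w, χ w * u n w = volume.real S * a := by
      rw [ha, hav n x, mul_inv_cancel_left₀ hSr.ne']
    have h0 : 0 ≤ ∫ w, (u n w - a * χ w) ^ 2 := integral_nonneg fun w => sq_nonneg _
    have e : ∫ w, (u n w - a * χ w) ^ 2 = (∫ w, u n w ^ 2) - volume.real S * a ^ 2 := by
      have : ∀ w, (u n w - a * χ w) ^ 2 = u n w ^ 2 - 2 * a * (χ w * u n w) + a ^ 2 * χ w := by
        intro w
        by_cases hw : w - x ∈ S <;> simp [hχ, hw]
        ring
      simp_rw [this]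
      have i3 : Integrable (fun w => u n w ^ 2 - 2 * a * (χ w * u n w)) :=
        (hu2 n).integrable_sq.sub (i1.const_mul _)
      rw [integral_add i3 (i2.const_mul _), integral_sub (hu2 n).integrable_sq (i1.const_mul _), integral_const_mul,
        integral_const_mul, e1, e2]
      ring
    rw [le_inv_mul_iff₀ hSr]
    linarith [hM n]
  have havt : Tendsto (fun n => ∫⁻ x in A, ENNReal.ofReal ((⨍ z in S, u n (x + z)) ^ 2)) atTop
      (𝓝 0) := by
    have : IsFiniteMeasure (volume.restrict A) := ⟨by simpa using hAt.lt_top⟩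
    have := tendsto_lintegral_of_dominated_convergence (μ := volume.restrict A)
      (F := fun n x => ENNReal.ofReal ((⨍ z in S, u n (x + z)) ^ 2)) (f := fun _ => 0)
      (fun _ => ENNReal.ofReal ((volume.real S)⁻¹ * M)) ?_
      (fun n => Eventually.of_forall fun x => ENNReal.ofReal_le_ofReal (hbd n x))
      (by rw [lintegral_const]; exact ENNReal.mul_ne_top ENNReal.ofReal_ne_top (by simpa using hAt))
      (Eventually.of_forall fun x => ?_)
    · simpa using this
    · intro n
      have : Measurable fun x => ∫ z in S, u n (x + z) :=
        (StronglyMeasurable.integral_prod_right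
          (f := fun (x : E) (z : E) => u n (x + z)) (by
            exact ((hum n).comp (measurable_fst.add measurable_snd)).stronglyMeasurable)).measurable
      simp_rw [setAverage_eq]
      fun_prop
    · have h1 := (hw _ (hindx x)).const_mul (volume.real S)⁻¹
      simp_rw [← hav] at h1
      have := (ENNReal.continuous_ofReal.tendsto _).comp (h1.pow 2)
      simpa [Function.comp_def] using this
  have h2 : Tendsto (fun n => 2 * ∫⁻ x in A, ENNReal.ofReal ((⨍ z in S, u n (x + z)) ^ 2)) atTop
      (𝓝 0) := by
    simpa using ENNReal.Tendsto.const_mul havt (Or.inr (by norm_num : (2 : ℝ≥0∞) ≠ ⊤))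
  filter_upwards [ENNReal.tendsto_nhds_zero.1 h2 (ε / 2) (ENNReal.half_pos hε.ne')] with n hn
  calc _ ≤ _ := (h n).lintegral_sq_le hA hS hSne hSδ hN (hum n) (hu n) (hu2 n) hz
    _ ≤ ε / 2 + ε / 2 := add_le_add hδε hn
    _ = ε := ENNReal.add_halves ε

end Compactness

/-! ### Cauchy–Schwarz and boundedness of weakly null sequences -/

section Integrals

variable {X : Type*} [MeasurableSpace X] {ν : Measure X}

lemma abs_integral_mul_le_sqrt {f g : X → ℝ} (hf : MemLp f 2 ν) (hg : MemLp g 2 ν) :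
    |∫ x, f x * g x ∂ν| ≤ √(∫ x, f x ^ 2 ∂ν) * √(∫ x, g x ^ 2 ∂ν) := by
  have hinner : ∀ {a b : X → ℝ} (ha : MemLp a 2 ν) (hb : MemLp b 2 ν),
      inner ℝ (ha.toLp a) (hb.toLp b) = ∫ x, a x * b x ∂ν := by
    intro a b ha hb
    rw [L2.inner_def]
    refine integral_congr_ae ?_
    filter_upwards [ha.coeFn_toLp, hb.coeFn_toLp] with x h1 h2
    simp [h1, h2, mul_comm]
  have hn : ∀ {a : X → ℝ} (ha : MemLp a 2 ν), ‖ha.toLp a‖ = √(∫ x, a x ^ 2 ∂ν) := by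
    intro a ha
    rw [norm_eq_sqrt_real_inner, hinner ha ha]
    simp [sq]
  have := abs_real_inner_le_norm (hf.toLp f) (hg.toLp g)
  rwa [hinner, hn, hn] at this

/-- Weakly null sequences in `L²` are bounded. -/
lemma exists_integral_norm_sq_le {V : Type*} [NormedAddCommGroup V] [InnerProductSpace ℝ V]
    [CompleteSpace V] {f : ℕ → X → V} (hf : ∀ n, MemLp (f n) 2 ν)
    (hw : ∀ g : X → V, MemLp g 2 ν → Tendsto (fun n => ∫ x, (inner ℝ (g x) (f n x) : ℝ) ∂ν)
      atTop (𝓝 0)) :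
    ∃ C : ℝ, ∀ n, ∫ x, ‖f n x‖ ^ 2 ∂ν ≤ C := by
  let φ : ℕ → Lp V 2 ν := fun n => (hf n).toLp (f n)
  -- The functionals ⟨φ n, ·⟩ are pointwise bounded because their values converge; their operator
  -- norms are the L² norms.
  obtain ⟨C, hC⟩ := banach_steinhaus (g := fun n => innerSL ℝ (φ n)) (fun ψ => by
    have h1 := hw ψ (Lp.memLp ψ)
    obtain ⟨C, hC⟩ := (Metric.isBounded_range_of_tendsto _ h1).exists_norm_le
    refine ⟨C, fun n => ?_⟩
    have := hC _ (mem_range_self n)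
    rw [innerSL_apply_apply, real_inner_comm, L2.inner_def]
    refine le_trans (le_of_eq ?_) this
    congr 1
    refine integral_congr_ae ?_
    filter_upwards [(hf n).coeFn_toLp] with x hx
    simp [φ, hx])
  refine ⟨C ^ 2, fun n => ?_⟩
  have h2 : ∫ x, ‖f n x‖ ^ 2 ∂ν = ‖φ n‖ ^ 2 := by
    rw [← real_inner_self_eq_norm_sq, L2.inner_def]
    refine integral_congr_ae ?_
    filter_upwards [(hf n).coeFn_toLp] with x hx
    simp [φ, hx]
  have := hC n
  rw [innerSL_apply_norm] at this
  rw [h2]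
  gcongr

end Integrals

/-! ### Weak gradients: uniqueness and the product rule -/

section WeakGradient

variable {d m : ℕ} {Ω : Set (Vec d)}

/-- The matrix `u ⊗ z` with entries `u_i z_j`. -/
def outer (u : Vec m) (z : Vec d) : Mat m d := WithLp.toLp 2 fun p => u p.1 * z p.2

@[simp] lemma outer_apply (u : Vec m) (z : Vec d) (p : Fin m × Fin d) :
    outer u z p = u p.1 * z p.2 := rfl

lemma norm_outer (u : Vec m) (z : Vec d) : ‖outer u z‖ = ‖u‖ * ‖z‖ := by
  have : ‖outer u z‖ ^ 2 = (‖u‖ * ‖z‖) ^ 2 := by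
    rw [mul_pow, EuclideanSpace.norm_sq_eq, EuclideanSpace.norm_sq_eq, EuclideanSpace.norm_sq_eq,
      Fintype.sum_prod_type, Finset.sum_mul_sum]
    simp [mul_pow]
  exact (sq_eq_sq₀ (norm_nonneg _) (by positivity)).1 this

lemma continuous_outer : Continuous fun p : Vec m × Vec d => outer p.1 p.2 := by
  unfold outer
  fun_prop

/-- The gradient of a scalar function, as a vector of partial derivatives. -/
def gradVec (θ : Vec d → ℝ) (x : Vec d) : Vec d :=
  WithLp.toLp 2 fun j => fderiv ℝ θ x (EuclideanSpace.single j 1)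

lemma continuous_gradVec {θ : Vec d → ℝ} (hθ : ContDiff ℝ ∞ θ) : Continuous (gradVec θ) := by
  have : Continuous (fderiv ℝ θ) := (hθ.continuous_fderiv (by simp))
  unfold gradVec
  fun_prop

lemma integrable_mul_of_hasCompactSupport {w φ : Vec d → ℝ} (hw : LocallyIntegrableOn w Ω)
    (hφ : Continuous φ) (hc : HasCompactSupport φ) (hs : tsupport φ ⊆ Ω) :
    Integrable (fun x => w x * φ x) (volume.restrict Ω) := by
  have h1 : IntegrableOn w (tsupport φ) := hw.integrableOn_compact_subset hs hc
  obtain ⟨C, hC⟩ := hc.exists_bound_of_continuous hφ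
  have h2 : IntegrableOn (fun x => w x * φ x) (tsupport φ) :=
    Integrable.mul_bdd h1 hφ.aestronglyMeasurable (Eventually.of_forall hC)
  have h3 : Integrable (fun x => w x * φ x) :=
    (integrableOn_iff_integrable_of_support_subset fun x hx => by
      refine subset_tsupport φ ?_
      simp only [Function.mem_support, ne_eq, mul_eq_zero, not_or] at hx ⊢
      exact hx.2).1 h2
  exact h3.restrict

lemma memLp_euclidean_apply {X ι : Type*} [MeasurableSpace X] {ν : Measure X} [Fintype ι]
    {p : ℝ≥0∞} {f : X → EuclideanSpace ℝ ι} (hf : MemLp f p ν) (i : ι) :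
    MemLp (fun x => f x i) p ν :=
  (EuclideanSpace.proj (𝕜 := ℝ) i).comp_memLp' hf

lemma locallyIntegrableOn_euclidean_apply {ι : Type*} [Fintype ι] {f : Vec d → EuclideanSpace ℝ ι}
    (hf : LocallyIntegrableOn f Ω) (i : ι) : LocallyIntegrableOn (fun x => f x i) Ω :=
  fun x hx => by
    obtain ⟨s, hs, h⟩ := hf x hx
    exact ⟨s, hs, (EuclideanSpace.proj (𝕜 := ℝ) i).integrable_comp h⟩

/-- The fundamental lemma of the calculus of variations, entry by entry. It makes the arbitrary
choice in `weakGrad` harmless under the integral. -/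
lemma HasWeakGrad.ae_eq (hΩ : IsOpen Ω) {u : Vec d → Vec m} {G G' : Vec d → Mat m d}
    (h : HasWeakGrad Ω u G) (h' : HasWeakGrad Ω u G') : G =ᵐ[volume.restrict Ω] G' := by
  have key : ∀ p : Fin m × Fin d, ∀ᵐ x ∂(volume.restrict Ω), G x p - G' x p = 0 := by
    rintro ⟨i, j⟩
    have hl := locallyIntegrableOn_euclidean_apply h.locInt_grad (i, j)
    have hl' := locallyIntegrableOn_euclidean_apply h'.locInt_grad (i, j)
    have := hΩ.ae_eq_zero_of_integral_contDiff_smul_eq_zero (f := fun x => G x (i, j) - G' x (i, j))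
      (hl.sub hl') (μ := volume) (fun φ h1 h2 h3 => by
        have e1 := h.integral_eq φ h1 h2 h3 i j
        have e2 := h'.integral_eq φ h1 h2 h3 i j
        have i1 := integrable_mul_of_hasCompactSupport hl h1.continuous h2 h3
        have i2 := integrable_mul_of_hasCompactSupport hl' h1.continuous h2 h3
        rw [← setIntegral_eq_integral_of_forall_compl_eq_zero (s := Ω)]
        · have : ∀ x, φ x • (G x (i, j) - G' x (i, j)) = G x (i, j) * φ x - G' x (i, j) * φ x :=
            fun x => by simp; ring
          simp_rw [this]
          rw [integral_sub i1 i2]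
          linarith
        · intro x hx
          rw [image_eq_zero_of_notMem_tsupport fun hx' => hx (h3 hx'), zero_smul])
    exact (ae_restrict_iff' hΩ.measurableSet).2 this
  filter_upwards [ae_all_iff.2 key] with x hx
  ext p
  linarith [hx p]

lemma HasWeakGrad.weakGrad {u : Vec d → Vec m} {G : Vec d → Mat m d} (h : HasWeakGrad Ω u G) :
    HasWeakGrad Ω u (weakGrad Ω u) := by
  have h' : ∃ G, HasWeakGrad Ω u G := ⟨G, h⟩
  unfold _root_.weakGrad
  rw [dif_pos h']
  exact h'.choose_spec

lemma HasWeakGrad.weakGrad_ae_eq (hΩ : IsOpen Ω) {u : Vec d → Vec m} {G : Vec d → Mat m d}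
    (h : HasWeakGrad Ω u G) : _root_.weakGrad Ω u =ᵐ[volume.restrict Ω] G :=
  h.weakGrad.ae_eq hΩ h

lemma LocallyIntegrableOn.continuous_bilinear {A B C : Type*} [NormedAddCommGroup A]
    [NormedAddCommGroup B] [NormedAddCommGroup C] (hΩ : IsOpen Ω) {f : Vec d → A} {g : Vec d → B}
    {T : A → B → C} (hT : Continuous fun p : A × B => T p.1 p.2) (hTn : ∀ a b, ‖T a b‖ ≤ ‖a‖ * ‖b‖)
    (hf : LocallyIntegrableOn f Ω) (hg : Continuous g) :
    LocallyIntegrableOn (fun x => T (f x) (g x)) Ω := by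
  rw [locallyIntegrableOn_iff hΩ.isLocallyClosed] at hf ⊢
  intro K hK hKc
  obtain ⟨C, hC⟩ := hKc.exists_bound_of_continuousOn hg.continuousOn
  have h1 := hf K hK hKc
  refine (h1.norm.mul_const C).mono'
    (hT.comp_aestronglyMeasurable (h1.aestronglyMeasurable.prodMk hg.aestronglyMeasurable)) ?_
  filter_upwards [ae_restrict_mem hKc.measurableSet] with x hx
  exact (hTn _ _).trans (by gcongr; exact hC x hx)

/-- Testing `u` against θφ, again an admissible test function, and expanding its derivative yields
the two terms of the product rule. -/
lemma HasWeakGrad.smooth_smul (hΩ : IsOpen Ω) {u : Vec d → Vec m} {G : Vec d → Mat m d}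
    (h : HasWeakGrad Ω u G) {θ : Vec d → ℝ} (hθ : ContDiff ℝ ∞ θ) :
    HasWeakGrad Ω (fun x => θ x • u x) (fun x => θ x • G x + outer (u x) (gradVec θ x)) := by
  refine ⟨?_, ?_, ?_⟩
  · exact LocallyIntegrableOn.continuous_bilinear hΩ (T := fun (a : Vec m) (b : ℝ) => b • a)
      (by fun_prop) (fun a b => by rw [norm_smul, mul_comm]) h.locInt hθ.continuous
  · refine LocallyIntegrableOn.add ?_ ?_
    · exact LocallyIntegrableOn.continuous_bilinear hΩ (T := fun (a : Mat m d) (b : ℝ) => b • a)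
        (by fun_prop) (fun a b => by rw [norm_smul, mul_comm]) h.locInt_grad hθ.continuous
    · exact LocallyIntegrableOn.continuous_bilinear hΩ (T := outer) continuous_outer
        (fun a b => (norm_outer a b).le) h.locInt (continuous_gradVec hθ)
  · intro φ h1 h2 h3 i j
    set e : Vec d := EuclideanSpace.single j 1
    have hsub : tsupport (fun x => θ x * φ x) ⊆ Ω := (tsupport_mul_subset_right (f := θ)).trans h3
    have hc : HasCompactSupport (fun x => θ x * φ x) := h2.mul_left
    have key := h.integral_eq (fun x => θ x * φ x) (hθ.mul h1) hc hsub i j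
    have hd : ∀ x, fderiv ℝ (fun x => θ x * φ x) x e =
        θ x * fderiv ℝ φ x e + φ x * fderiv ℝ θ x e := by
      intro x
      rw [fderiv_fun_mul (hθ.differentiable (by simp) x) (h1.differentiable (by simp) x)]
      simp
    have hu := locallyIntegrableOn_euclidean_apply h.locInt i
    have hG := locallyIntegrableOn_euclidean_apply h.locInt_grad (i, j)
    have cθ : Continuous fun x => fderiv ℝ θ x e :=
      (hθ.continuous_fderiv (by simp)).clm_apply continuous_const
    have cφ : Continuous fun x => fderiv ℝ φ x e :=
      (h1.continuous_fderiv (by simp)).clm_apply continuous_const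
    have cφc : HasCompactSupport fun x => fderiv ℝ φ x e := h2.fderiv_apply ℝ e
    have cφs : tsupport (fun x => fderiv ℝ φ x e) ⊆ Ω :=
      (tsupport_fderiv_apply_subset ℝ e).trans h3
    have i1 : Integrable (fun x => u x i * (θ x * fderiv ℝ φ x e)) (volume.restrict Ω) :=
      integrable_mul_of_hasCompactSupport hu (hθ.continuous.mul cφ) cφc.mul_left
        ((tsupport_mul_subset_right (f := θ)).trans cφs)
    have i2 : Integrable (fun x => u x i * (φ x * fderiv ℝ θ x e)) (volume.restrict Ω) :=
      integrable_mul_of_hasCompactSupport hu (h1.continuous.mul cθ) h2.mul_right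
        ((tsupport_mul_subset_left (f := φ)).trans h3)
    have i3 : Integrable (fun x => G x (i, j) * (θ x * φ x)) (volume.restrict Ω) :=
      integrable_mul_of_hasCompactSupport hG (hθ.continuous.mul h1.continuous) hc hsub
    have e1 : ∫ x in Ω, u x i * fderiv ℝ (fun x => θ x * φ x) x e =
        (∫ x in Ω, u x i * (θ x * fderiv ℝ φ x e)) + ∫ x in Ω, u x i * (φ x * fderiv ℝ θ x e) := by
      rw [← integral_add i1 i2]
      simp_rw [hd, mul_add]
    have e2 : ∫ x in Ω, (θ x • G x + outer (u x) (gradVec θ x)) (i, j) * φ x =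
        (∫ x in Ω, G x (i, j) * (θ x * φ x)) + ∫ x in Ω, u x i * (φ x * fderiv ℝ θ x e) := by
      rw [← integral_add i3 i2]
      congr 1; ext x
      simp [gradVec, e]
      ring
    have e3 : ∫ x in Ω, (θ x • u x) i * fderiv ℝ φ x e =
        ∫ x in Ω, u x i * (θ x * fderiv ℝ φ x e) := by
      congr 1; ext x
      simp
      ring
    rw [e2, e3]
    linarith

lemma HasWeakGrad.const_smul (hΩ : IsOpen Ω) {u : Vec d → Vec m} {G : Vec d → Mat m d}
    (h : HasWeakGrad Ω u G) (c : ℝ) : HasWeakGrad Ω (fun x => c • u x) (fun x => c • G x) := by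
  have := h.smooth_smul hΩ (θ := fun _ => c) contDiff_const
  have e : ∀ x, outer (u x) (gradVec (fun _ : Vec d => c) x) = 0 := fun x => by
    ext p; simp [gradVec]
  simpa [e] using this

end WeakGradient

/-! ### Geometry of C¹ domains and strong L² convergence -/

section Domain

variable {d m : ℕ} {Ω : Set (Vec d)}

/-- At interior points any small ball of directions works. At a boundary point the graph function is
locally Lipschitz, so the region above it is invariant under short moves in directions close to `e`:
the height gained exceeds the possible rise of the graph. -/
lemma IsC1Domain.hasOpenSegments (hΩ : IsC1Domain Ω) : HasOpenSegments Ω := by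
  intro x₀ hx₀
  by_cases hx : x₀ ∈ Ω
  · obtain ⟨r, hr, hball⟩ := Metric.isOpen_iff.1 hΩ.isOpen x₀ hx
    refine ⟨r / 2, by positivity, fun δ hδ => ⟨Metric.ball 0 (min δ (r / 2)), Metric.isOpen_ball,
      ⟨0, by simp [hδ, hr]⟩, Metric.ball_subset_ball (min_le_left _ _), ?_⟩⟩
    rintro z hz x ⟨-, hx⟩ s ⟨hs0, hs1⟩
    apply hball
    rw [mem_ball_zero_iff] at hz
    rw [Metric.mem_ball, dist_eq_norm] at hx ⊢
    have h1 : ‖s • z‖ ≤ ‖z‖ := by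
      rw [norm_smul, Real.norm_of_nonneg hs0]
      exact mul_le_of_le_one_left (norm_nonneg _) hs1
    calc ‖x + s • z - x₀‖ = ‖(x - x₀) + s • z‖ := by congr 1; abel
      _ ≤ ‖x - x₀‖ + ‖s • z‖ := norm_add_le _ _
      _ < r := by linarith [min_le_right δ (r / 2)]
  have hfr : x₀ ∈ frontier Ω := ⟨hx₀, by rwa [hΩ.isOpen.interior_eq]⟩
  obtain ⟨r, hr, e, he, γ, hγ, hgraph⟩ := hΩ.boundary x₀ hfr
  set P : Vec d → Vec d := fun x => x - (inner ℝ e x : ℝ) • e with hP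
  have hPadd : ∀ x z (s : ℝ), P (x + s • z) = P x + s • P z := by
    intro x z s
    simp only [hP, inner_add_right, inner_smul_right]
    module
  have hPc : Continuous P := by fun_prop
  have hee : inner ℝ e e = (1 : ℝ) := by rw [real_inner_self_eq_norm_sq, he]; norm_num
  have hPn : ∀ z, ‖P z‖ ≤ 2 * ‖z‖ := by
    intro z
    have h1 := abs_real_inner_le_norm e z
    calc ‖P z‖ ≤ ‖z‖ + ‖(inner ℝ e z : ℝ) • e‖ := norm_sub_le _ _
      _ ≤ 2 * ‖z‖ := by
        rw [norm_smul, he, Real.norm_eq_abs]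
        rw [he] at h1
        linarith
  obtain ⟨K, t, ht, hLip⟩ := (hγ.contDiffAt (x := P x₀)).exists_lipschitzOnWith
  obtain ⟨ρ, hρ, hρt⟩ := Metric.mem_nhds_iff.1 (hPc.continuousAt.preimage_mem_nhds ht)
  set r' := min r ρ / 2 with hr'
  have hr'0 : 0 < r' := by positivity
  -- Opening of the cone. For z = τe + w the height grows by at least τ - ‖w‖ and the graph by at
  -- most 2K‖w‖; the condition (2K + 1)‖w‖ ≤ τ follows from ‖w‖ < τc.
  set c : ℝ := 1 / (2 * K + 2) with hc
  have hc0 : 0 < c := by positivity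
  have hcK : c * (2 * K + 2) = 1 := by rw [hc]; field_simp
  have hc1 : c ≤ 1 := by
    have : 0 ≤ c * K := by positivity
    linarith
  refine ⟨r', hr'0, fun δ hδ => ?_⟩
  set τ : ℝ := min δ r' / 4 with hτ
  have hτ0 : 0 < τ := by positivity
  have hτδ : 4 * τ ≤ δ := by rw [hτ]; linarith [min_le_left δ r']
  have hτr : 4 * τ ≤ r' := by rw [hτ]; linarith [min_le_right δ r']
  have hSn : ∀ z ∈ Metric.ball (τ • e) (τ * c), ‖z‖ < 4 * τ := by
    intro z hz
    rw [Metric.mem_ball, dist_eq_norm] at hz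
    calc ‖z‖ = ‖τ • e + (z - τ • e)‖ := by congr 1; abel
      _ ≤ ‖τ • e‖ + ‖z - τ • e‖ := norm_add_le _ _
      _ < 4 * τ := by
        rw [norm_smul, he, Real.norm_of_nonneg hτ0.le]
        nlinarith
  refine ⟨Metric.ball (τ • e) (τ * c), Metric.isOpen_ball, ⟨τ • e, by simp; positivity⟩, ?_, ?_⟩
  · intro z hz
    rw [mem_ball_zero_iff]
    linarith [hSn z hz]
  rintro z hz x ⟨hxΩ, hx⟩ s ⟨hs0, hs1⟩
  have hzn := hSn z hz
  have hsz : ‖s • z‖ ≤ ‖z‖ := by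
    rw [norm_smul, Real.norm_of_nonneg hs0]
    exact mul_le_of_le_one_left (norm_nonneg _) hs1
  rw [Metric.mem_ball, dist_eq_norm] at hz hx
  have hx'n : ‖x + s • z - x₀‖ < 2 * r' := by
    calc ‖x + s • z - x₀‖ = ‖(x - x₀) + s • z‖ := by congr 1; abel
      _ ≤ ‖x - x₀‖ + ‖s • z‖ := norm_add_le _ _
      _ < 2 * r' := by linarith
  have hr1 : 2 * r' ≤ r := by rw [hr']; linarith [min_le_left r ρ]
  have hr2 : 2 * r' ≤ ρ := by rw [hr']; linarith [min_le_right r ρ]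
  have hxr : x ∈ Metric.ball x₀ r := by rw [Metric.mem_ball, dist_eq_norm]; linarith
  have hx'r : x + s • z ∈ Metric.ball x₀ r := by rw [Metric.mem_ball, dist_eq_norm]; linarith
  have m1 : P x ∈ t := hρt (by rw [Metric.mem_ball, dist_eq_norm]; linarith)
  have m2 : P (x + s • z) ∈ t := hρt (by rw [Metric.mem_ball, dist_eq_norm]; linarith)
  rw [hgraph _ hx'r]
  have hxg := (hgraph _ hxr).1 hxΩ
  change γ (P x) < _ at hxg
  change γ (P (x + s • z)) < _
  set w := z - τ • e with hw
  -- `P` annihilates `e`, so only the deviation `w` moves the base point of the graph.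
  have hPz : P z = P w := by
    simp only [hP, hw, inner_sub_right, inner_smul_right, hee]
    module
  have hl := hLip.dist_le_mul _ m2 _ m1
  rw [hPadd, dist_eq_norm, dist_eq_norm, add_sub_cancel_left, norm_smul, hPz,
    Real.norm_of_nonneg hs0] at hl
  rw [hPadd, hPz]
  have hl2 := (abs_le.1 hl).2
  have hin : τ - ‖w‖ ≤ inner ℝ e z := by
    have h1 := abs_real_inner_le_norm e w
    have h2 : inner ℝ e z = τ + (inner ℝ e w : ℝ) := by
      simp only [hw, inner_sub_right, inner_smul_right, hee]; ring
    rw [he] at h1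
    linarith [(abs_le.1 h1).1]
  rw [inner_add_right, inner_smul_right]
  have hKw : K * (s * ‖P w‖) ≤ s * (2 * K * ‖w‖) := by
    have := mul_le_mul_of_nonneg_left (hPn w) (by positivity : 0 ≤ K * s)
    linarith
  have hfin : 2 * K * ‖w‖ ≤ τ - ‖w‖ := by
    have h1 : (2 * K + 1) * ‖w‖ ≤ (2 * K + 2) * (τ * c) := by
      have : (0 : ℝ) ≤ K := K.2
      nlinarith [norm_nonneg w]
    nlinarith
  have := mul_le_mul_of_nonneg_left (hfin.trans hin) hs0
  linarith

/-- The derivative of u_i in direction z is (G, e_i ⊗ z), and |e_i ⊗ z| = |z|, so Cauchy–Schwarz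
gives the bound. The function `w` stands for u_i extended by zero to the whole space. -/
lemma HasWeakGrad.derivBound {u : Vec d → Vec m} {G : Vec d → Mat m d}
    (h : HasWeakGrad Ω u G) (hG : MemLp G 2 (volume.restrict Ω)) {N : ℝ}
    (hN : √(∫ x in Ω, ‖G x‖ ^ 2) ≤ N) (i : Fin m) {w : Vec d → ℝ}
    (hw0 : ∀ x ∉ Ω, w x = 0) (hw : w =ᵐ[volume.restrict Ω] fun x => u x i) :
    DerivBound Ω w N := by
  intro ψ h1 h2 h3 z
  have hz : ∀ x, fderiv ℝ ψ x z = ∑ j, z j * fderiv ℝ ψ x (EuclideanSpace.single j 1) := by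
    intro x
    conv_lhs => rw [← (EuclideanSpace.basisFun (Fin d) ℝ).sum_repr z]
    simp
  have e0 : ∫ x, w x * fderiv ℝ ψ x z = ∫ x in Ω, u x i * fderiv ℝ ψ x z := by
    rw [← setIntegral_eq_integral_of_forall_compl_eq_zero (s := Ω) fun x hx => by simp [hw0 x hx]]
    refine integral_congr_ae ?_
    filter_upwards [hw] with x hx
    simp [hx]
  have hψm : MemLp ψ 2 (volume.restrict Ω) := (h1.continuous.memLp_of_hasCompactSupport h2)
  set Z : Mat m d := outer (EuclideanSpace.single i 1) z with hZ
  have hGZ : ∀ x, inner ℝ (G x) Z = ∑ j, z j * G x (i, j) := by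
    intro x
    simp [PiLp.inner_apply, hZ, Fintype.sum_prod_type, ite_mul]
  have i1 : ∀ j, Integrable (fun x => u x i * fderiv ℝ ψ x (EuclideanSpace.single j 1))
      (volume.restrict Ω) := fun j =>
    integrable_mul_of_hasCompactSupport (locallyIntegrableOn_euclidean_apply h.locInt i)
      ((h1.continuous_fderiv (by simp)).clm_apply continuous_const)
      (h2.fderiv_apply ℝ _) ((tsupport_fderiv_apply_subset ℝ _).trans h3)
  have i2 : ∀ j, Integrable (fun x => G x (i, j) * ψ x) (volume.restrict Ω) := fun j =>
    integrable_mul_of_hasCompactSupport (locallyIntegrableOn_euclidean_apply h.locInt_grad (i, j)) h1.continuous h2 h3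
  have e1 : ∫ x in Ω, u x i * fderiv ℝ ψ x z = -∫ x in Ω, inner ℝ (G x) Z * ψ x := by
    simp_rw [hz, hGZ, Finset.mul_sum, Finset.sum_mul]
    rw [integral_finsetSum, integral_finsetSum, ← Finset.sum_neg_distrib]
    · refine Finset.sum_congr rfl fun j _ => ?_
      have := h.integral_eq ψ h1 h2 h3 i j
      have a1 : ∀ x, u x i * (z j * fderiv ℝ ψ x (EuclideanSpace.single j 1)) =
        z j * (u x i * fderiv ℝ ψ x (EuclideanSpace.single j 1)) := fun x => by ring
      simp_rw [a1, mul_assoc]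
      rw [integral_const_mul, integral_const_mul, this]
      ring
    · intro j _
      exact ((i2 j).const_mul (z j)).congr (Eventually.of_forall fun x => by ring)
    · intro j _
      exact ((i1 j).const_mul (z j)).congr (Eventually.of_forall fun x => by ring)
  have hGm : MemLp (fun x => (inner ℝ (G x) Z : ℝ)) 2 (volume.restrict Ω) := hG.inner_const Z
  rw [e0, e1, abs_neg]
  refine (abs_integral_mul_le_sqrt hGm hψm).trans ?_
  have b1 : √(∫ x in Ω, (inner ℝ (G x) Z : ℝ) ^ 2) ≤ N * ‖z‖ := by
    have hZn : ‖Z‖ = ‖z‖ := by rw [hZ, norm_outer]; simp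
    calc √(∫ x in Ω, (inner ℝ (G x) Z : ℝ) ^ 2) ≤ √(∫ x in Ω, ‖G x‖ ^ 2 * ‖z‖ ^ 2) := by
          refine Real.sqrt_le_sqrt (integral_mono hGm.integrable_sq
            (hG.integrable_norm_pow (by norm_num) |>.mul_const _) fun x => ?_)
          have := abs_real_inner_le_norm (G x) Z
          rw [hZn] at this
          simp only
          rw [← sq_abs, ← mul_pow]
          gcongr
      _ = √(∫ x in Ω, ‖G x‖ ^ 2) * ‖z‖ := by
          rw [integral_mul_const, Real.sqrt_mul' _ (by positivity), Real.sqrt_sq (norm_nonneg _)]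
      _ ≤ N * ‖z‖ := by gcongr
  have b2 : ∫ x in Ω, ψ x ^ 2 = ∫ x, ψ x ^ 2 :=
    setIntegral_eq_integral_of_forall_compl_eq_zero fun x hx => by
      rw [image_eq_zero_of_notMem_tsupport fun hx' => hx (h3 hx')]; simp
  rw [b2]
  gcongr

lemma MemW1.weakGrad_spec (hΩ : IsOpen Ω) {p : ℝ≥0∞} {u : Vec d → Vec m} (h : MemW1 Ω p u) :
    HasWeakGrad Ω u (weakGrad Ω u) ∧ MemLp (weakGrad Ω u) p (volume.restrict Ω) := by
  obtain ⟨-, G, hG, hGm⟩ := h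
  exact ⟨hG.weakGrad, (memLp_congr_ae (hG.weakGrad_ae_eq hΩ)).2 hGm⟩

/-- Weakly null sequences in `W^{1,2}` of a bounded `C¹` domain converge strongly in `L²`. -/
theorem WeaklyNullW12.tendsto_integral_norm_sq (hΩ : IsC1Domain Ω) {v : ℕ → Vec d → Vec m}
    (hv : WeaklyNullW12 Ω v) : Tendsto (fun n => ∫ x in Ω, ‖v n x‖ ^ 2) atTop (𝓝 0) := by
  have hfin : IsFiniteMeasure (volume.restrict Ω) :=
    ⟨by simpa using hΩ.isBounded.measure_lt_top⟩
  have hv2 : ∀ n, MemLp (v n) 2 (volume.restrict Ω) := fun n => (hv.1 n).1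
  have hG := fun n => (hv.1 n).weakGrad_spec hΩ.isOpen
  have hw1 : ∀ g : Vec d → Vec m, MemLp g 2 (volume.restrict Ω) →
      Tendsto (fun n => ∫ x in Ω, (inner ℝ (g x) (v n x) : ℝ)) atTop (𝓝 0) := fun g hg => by
    simpa using hv.2 g 0 hg MemLp.zero
  obtain ⟨M, hM⟩ := exists_integral_norm_sq_le hv2 hw1
  obtain ⟨C, hC⟩ := exists_integral_norm_sq_le (fun n => (hG n).2) (fun g hg => by
    simpa using hv.2 0 g MemLp.zero hg)
  have comp : ∀ i : Fin m, Tendsto (fun n => ∫ x in Ω, (v n x i) ^ 2) atTop (𝓝 0) := by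
    intro i
    -- A measurable representative of the i-th component, extended by zero: the compactness theorem
    -- works with measurable functions on the whole space.
    set w : ℕ → Vec d → ℝ := fun n => Ω.indicator fun x => (hv2 n).1.mk (v n) x i with hw
    have hwae : ∀ n, w n =ᵐ[volume.restrict Ω] fun x => v n x i := by
      intro n
      filter_upwards [(hv2 n).1.ae_eq_mk, ae_restrict_mem hΩ.isOpen.measurableSet] with x hx hxΩ
      simp [hw, hxΩ, ← hx]
    have hw0 : ∀ n, ∀ x ∉ Ω, w n x = 0 := fun n x hx => indicator_of_notMem hx _
    have hvi : ∀ n, MemLp (fun x => v n x i) 2 (volume.restrict Ω) := fun n =>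
      memLp_euclidean_apply (hv2 n) i
    have hwm : ∀ n, Measurable (w n) := fun n => by
      have : Measurable ((hv2 n).1.mk (v n)) := (hv2 n).1.stronglyMeasurable_mk.measurable
      exact Measurable.indicator (by fun_prop) hΩ.isOpen.measurableSet
    have hw2 : ∀ n, MemLp (w n) 2 := fun n => by
      have h1 : MemLp (w n) 2 (volume.restrict Ω) := (memLp_congr_ae (hwae n)).2 (hvi n)
      have h2 := (memLp_indicator_iff_restrict hΩ.isOpen.measurableSet).2 h1
      simpa [hw, indicator_indicator] using h2
    have hwint : ∀ n, Integrable (w n) := fun n => by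
      have h1 : IntegrableOn (w n) Ω := ((memLp_congr_ae (hwae n)).2 (hvi n)).integrable
        (by norm_num)
      exact (integrableOn_iff_integrable_of_support_subset fun x hx => by
        by_contra hxΩ; exact hx (hw0 n x hxΩ)).1 h1
    have hsq : ∀ n, ∫ x, w n x ^ 2 = ∫ x in Ω, (v n x i) ^ 2 := fun n => by
      rw [← setIntegral_eq_integral_of_forall_compl_eq_zero (s := Ω)
        fun x hx => by simp [hw0 n x hx]]
      exact integral_congr_ae ((hwae n).fun_comp (· ^ 2))
    have hR := tendsto_lintegral_sq_of_weaklyNull hΩ.isOpen hΩ.isBounded hΩ.hasOpenSegments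
      (u := w) (N := √C) (M := M) (Real.sqrt_nonneg _)
      (fun n => (hG n).1.derivBound (hG n).2 (Real.sqrt_le_sqrt (hC n)) i (hw0 n) (hwae n))
      hwm hwint hw2 (fun n => by
        rw [hsq]
        refine le_trans (integral_mono (hvi n).integrable_sq
          ((hv2 n).integrable_norm_pow (by norm_num)) fun x => ?_) (hM n)
        simp only
        rw [← sq_abs, ← Real.norm_eq_abs]
        gcongr
        exact PiLp.norm_apply_le (v n x) i)
      (fun g hg => by
        have h1 := hw1 (fun x => g x • EuclideanSpace.single i 1) (by
          refine (hg.restrict Ω).of_le (((hg.restrict Ω).1).smul_const _)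
            (Eventually.of_forall fun x => by simp [norm_smul]))
        refine h1.congr fun n => ?_
        have e : ∫ x in Ω, g x * w n x = ∫ x, g x * w n x :=
          setIntegral_eq_integral_of_forall_compl_eq_zero fun x hx => by simp [hw0 n x hx]
        rw [← e]
        refine integral_congr_ae ?_
        filter_upwards [hwae n] with x hx
        simp [hx, inner_smul_left, EuclideanSpace.inner_single_left])
    have := (ENNReal.tendsto_toReal ENNReal.zero_ne_top).comp hR
    refine this.congr fun n => ?_
    rw [← hsq, Function.comp_apply, ← integral_eq_lintegral_of_nonneg_ae
      (Eventually.of_forall fun x => sq_nonneg _) ((hw2 n).integrable_sq.restrict.1)]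
    exact setIntegral_eq_integral_of_forall_compl_eq_zero fun x hx => by simp [hw0 n x hx]
  have hsum := tendsto_finsetSum Finset.univ fun i _ => comp i
  simp only [Finset.sum_const_zero] at hsum
  refine hsum.congr fun n => ?_
  rw [← integral_finsetSum]
  · congr 1; ext x
    simp [EuclideanSpace.norm_sq_eq]
  · intro i _
    exact (memLp_euclidean_apply (hv2 n) i).integrable_sq

end Domain

/-! ### Second-order Taylor expansion -/

section Taylor

variable {V : Type*} [NormedAddCommGroup V] [NormedSpace ℝ V]

/-- The remainder has derivative Df(a + k) - Df(a) - D²f(a)k, which is o(‖k‖); the mean value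
inequality on [0, h] gains one more power. Symmetry of D²f(a) is needed to differentiate the
quadratic term. -/
lemma isLittleO_taylor_two {f : V → ℝ} {a : V} (hf : ContDiffAt ℝ 2 f a) :
    (fun h => f (a + h) - f a - fderiv ℝ f a h - fderiv ℝ (fderiv ℝ f) a h h / 2) =o[𝓝 0]
      fun h => ‖h‖ ^ 2 := by
  have hsymm : IsSymmSndFDerivAt ℝ f a := hf.isSymmSndFDerivAt (by simp)
  have hd : ∀ᶠ h in 𝓝 (0 : V), DifferentiableAt ℝ f (a + h) := by
    have h1 : ∀ᶠ y in 𝓝 a, DifferentiableAt ℝ f y :=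
      (hf.eventually (by simp)).mono fun y hy => hy.differentiableAt (by norm_num)
    have h2 : Tendsto (fun h : V => a + h) (𝓝 0) (𝓝 a) := by
      have : Continuous fun h : V => a + h := by fun_prop
      simpa using this.tendsto 0
    exact h2.eventually h1
  have hdd : DifferentiableAt ℝ (fderiv ℝ f) a :=
    (hf.fderiv_right (m := 1) (by norm_num)).differentiableAt (by norm_num)
  have hlo := (hasFDerivAt_iff_isLittleO_nhds_zero.1 hdd.hasFDerivAt)
  rw [Asymptotics.isLittleO_iff] at hlo ⊢
  intro c hc
  obtain ⟨ε, hε, hball⟩ := Metric.eventually_nhds_iff_ball.1 ((hlo hc).and hd)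
  refine Metric.eventually_nhds_iff_ball.2 ⟨ε, hε, fun h hh => ?_⟩
  set φ : V → ℝ := fun h => f (a + h) - f a - fderiv ℝ f a h - fderiv ℝ (fderiv ℝ f) a h h / 2
  have hφ : ∀ k ∈ Metric.ball (0 : V) ε,
      HasFDerivAt φ (fderiv ℝ f (a + k) - fderiv ℝ f a - fderiv ℝ (fderiv ℝ f) a k) k := by
    intro k hk
    have e1 : HasFDerivAt (fun h => f (a + h)) (fderiv ℝ f (a + k)) k := by
      have := (hball k hk).2.hasFDerivAt
      exact this.comp k ((hasFDerivAt_id k).const_add a)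
    have e2 : HasFDerivAt (fun h => fderiv ℝ (fderiv ℝ f) a h h)
        ((2 : ℝ) • fderiv ℝ (fderiv ℝ f) a k) k := by
      have := (fderiv ℝ (fderiv ℝ f) a).hasFDerivAt (x := k) |>.clm_apply (hasFDerivAt_id k)
      refine this.congr_fderiv ?_
      ext y
      simp [two_mul, hsymm.eq y k]
    have e3 := ((e1.sub_const (f a)).sub (fderiv ℝ f a).hasFDerivAt).sub (e2.mul_const (1 / 2 : ℝ))
    have e4 : HasFDerivAt φ _ k := e3.congr_of_eventuallyEq
      (Eventually.of_forall fun y => by simp [φ]; ring)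
    refine e4.congr_fderiv ?_
    ext y
    simp
  have hseg : segment ℝ 0 h ⊆ Metric.ball (0 : V) ε :=
    (convex_ball (0 : V) ε).segment_subset (Metric.mem_ball_self hε) hh
  have hmv := (convex_segment (0 : V) h).norm_image_sub_le_of_norm_hasFDerivWithin_le (𝕜 := ℝ)
    (f := φ) (C := c * ‖h‖) (fun k hk => (hφ k (hseg hk)).hasFDerivWithinAt) (fun k hk => by
      refine (hball k (hseg hk)).1.trans ?_
      gcongr
      obtain ⟨s, t, hs, ht, hst, rfl⟩ := hk
      rw [smul_zero, zero_add, norm_smul, Real.norm_of_nonneg ht]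
      exact mul_le_of_le_one_left (norm_nonneg _) (by linarith))
    (left_mem_segment ℝ 0 h) (right_mem_segment ℝ 0 h)
  have h0 : φ 0 = 0 := by simp [φ]
  rw [h0, sub_zero, sub_zero] at hmv
  rw [norm_pow, norm_norm]
  linarith

end Taylor

/-! ### The reduced Lagrangian and the splitting of the energy -/

section Lagrangian

variable {d m : ℕ} {Ω : Set (Vec d)} {F : Vec d → Mat m d} {W : Vec d → Mat m d → ℝ}

lemma IsLagrangian.continuous (hW : IsLagrangian Ω F W) {x : Vec d} (hx : x ∈ closure Ω) :
    Continuous (W x) :=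
  hW.continuousOn.comp_continuous (f := fun H : Mat m d => (x, H)) (by fun_prop)
    fun H => ⟨hx, mem_univ _⟩

/-- Away from H = 0 this is a quotient of continuous functions. At H = 0 it is exactly Taylor's
theorem at F(x), the value there being 0 by the convention for division by zero. -/
lemma IsLagrangian.continuous_Ufun (hW : IsLagrangian Ω F W) {x : Vec d} (hx : x ∈ closure Ω) :
    Continuous (Ufun W F x) := by
  have hWc := hW.continuous hx
  have hnum : Continuous fun H => Wcirc W F x H - quadL W F x H / 2 := by
    unfold Wcirc quadL
    fun_prop
  rw [continuous_iff_continuousAt]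
  intro H
  by_cases hH : H = 0
  · obtain ⟨O, hO, hFO, hc2, -⟩ := hW.c2
    have h1 : ContDiffAt ℝ 2 (W x) (F x) :=
      (hc2 x hx).contDiffAt (hO.mem_nhds (hFO (mem_image_of_mem F hx)))
    have h2 := (isLittleO_taylor_two h1).tendsto_div_nhds_zero
    subst hH
    have h0 : Ufun W F x 0 = 0 := by simp [Ufun]
    rw [ContinuousAt, h0]
    exact h2
  · exact hnum.continuousAt.div (by fun_prop) (by simpa using hH)

/-- Separates the part tested against `μ`, which sees α only through αG, from the quadratic part
tested against `lam`, which is free of α. -/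
lemma scriptF_eq {x : Vec d} {α : ℝ} (hα : 0 < α) (G : Mat m d) :
    scriptF W F x α G = Ufun W F x (α • G) * ‖G‖ ^ 2 + quadL W F x G / 2 := by
  by_cases hG : G = 0
  · simp [hG, scriptF, Wcirc, quadL]
  have hn : ‖G‖ ≠ 0 := by simpa using hG
  have hq : quadL W F x (α • G) = α ^ 2 * quadL W F x G := by
    simp [quadL]; ring
  rw [scriptF, Ufun, norm_smul, Real.norm_of_nonneg hα.le, hq]
  field_simp
  ring

@[simp] lemma scriptF_zero {x : Vec d} {α : ℝ} : scriptF W F x α 0 = 0 := by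
  simp [scriptF, Wcirc]

end Lagrangian

lemma integrable_bilinear {X V : Type*} [MeasurableSpace X] {ν : Measure X}
    [NormedAddCommGroup V] [NormedSpace ℝ V] (L : V →L[ℝ] V →L[ℝ] ℝ) {H : X → V} (hH : MemLp H 2 ν) :
    Integrable (fun x => L (H x) (H x)) ν := by
  refine ((hH.integrable_norm_pow (p := 2) (by norm_num)).const_mul ‖L‖).mono'
    ((by fun_prop : Continuous fun y => L y y).comp_aestronglyMeasurable hH.1)
    (Eventually.of_forall fun x => ?_)
  refine (L.le_opNorm₂ _ _).trans (le_of_eq (by ring))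

/-! ### Stability of the energy under strongly vanishing perturbations -/

section Perturbation

variable {X V : Type*} [MeasurableSpace X] {ν : Measure X} [NormedAddCommGroup V]
  [InnerProductSpace ℝ V] [FiniteDimensional ℝ V]

/-- Uniform continuity handles ‖B‖ < δ; for ‖B‖ ≥ δ the crude bound 2 sup|U| is absorbed into a
multiple of ‖B‖. -/
lemma exists_abs_sub_le_of_continuous {U : V → ℝ} (hU : Continuous U) (C : ℝ) {ε : ℝ} (hε : 0 < ε) :
    ∃ K : ℝ, 0 ≤ K ∧ ∀ A B : V, ‖A‖ ≤ C → ‖A + B‖ ≤ C → |U (A + B) - U A| ≤ ε + K * ‖B‖ := by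
  have hcomp : IsCompact (Metric.closedBall (0 : V) C) := isCompact_closedBall 0 C
  obtain ⟨M, hM⟩ := hcomp.exists_bound_of_continuousOn hU.continuousOn
  have huc := hcomp.uniformContinuousOn_of_continuous hU.continuousOn
  obtain ⟨δ, hδ, hδU⟩ := Metric.uniformContinuousOn_iff.1 huc ε hε
  refine ⟨2 * |M| / δ, by positivity, fun A B hA hAB => ?_⟩
  have mA : A ∈ Metric.closedBall (0 : V) C := by simpa using hA
  have mAB : A + B ∈ Metric.closedBall (0 : V) C := by simpa using hAB
  by_cases hB : ‖B‖ < δ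
  · have := hδU _ mAB _ mA (by simpa [dist_eq_norm] using hB)
    rw [Real.dist_eq] at this
    have : 0 ≤ 2 * |M| / δ * ‖B‖ := by positivity
    linarith
  · have h1 := hM _ mA
    have h2 := hM _ mAB
    rw [Real.norm_eq_abs] at h1 h2
    have h3 : 1 ≤ ‖B‖ / δ := by rw [le_div_iff₀ hδ]; linarith
    have h4 : 2 * |M| ≤ 2 * |M| * (‖B‖ / δ) := le_mul_of_one_le_right (by positivity) h3
    have h5 : 2 * |M| / δ * ‖B‖ = 2 * |M| * (‖B‖ / δ) := by ring
    have := abs_sub (U (A + B)) (U A)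
    have := le_abs_self M
    linarith

/-- Changing the gradients by a sequence that converges strongly to zero does not affect the limit
of the rescaled energies. -/
lemma tendsto_integral_energy_sub {U : V → ℝ} (hU : Continuous U) (L : V →L[ℝ] V →L[ℝ] ℝ)
    {α : ℕ → ℝ} {G g : ℕ → X → V} (hG : ∀ n, MemLp (G n) 2 ν)
    (hg : ∀ n, MemLp (g n) 2 ν) {M C : ℝ} (hM : ∀ n, ∫ x, ‖G n x‖ ^ 2 ∂ν ≤ M)
    (hg0 : Tendsto (fun n => ∫ x, ‖g n x‖ ^ 2 ∂ν) atTop (𝓝 0))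
    (hGC : ∀ n, ∀ᵐ x ∂ν, ‖α n • G n x‖ ≤ C) (hgC : ∀ n, ∀ᵐ x ∂ν, ‖α n • g n x‖ ≤ C) :
    Tendsto (fun n => ∫ x, ((U (α n • (G n x + g n x)) * ‖G n x + g n x‖ ^ 2 +
        L (G n x + g n x) (G n x + g n x) / 2) -
      (U (α n • G n x) * ‖G n x‖ ^ 2 + L (G n x) (G n x) / 2)) ∂ν) atTop (𝓝 0) := by
  obtain ⟨B, hB⟩ := (isCompact_closedBall (0 : V) (2 * |C|)).exists_bound_of_continuousOn
    hU.continuousOn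
  rw [Metric.tendsto_atTop]
  intro ε hε
  -- Chosen so that ε' ∫ |G_n|² < ε/2.
  set ε' := ε / (2 * (|M| + 1)) with hε'
  have hε'0 : 0 < ε' := by positivity
  obtain ⟨K, hK0, hK⟩ := exists_abs_sub_le_of_continuous hU (2 * |C|) hε'0
  set K1 : ℝ := K * |C| + 2 * |B| + ‖L‖ with hK1
  have hlim : Tendsto (fun n => K1 * (√M * √(∫ x, ‖g n x‖ ^ 2 ∂ν) + ∫ x, ‖g n x‖ ^ 2 ∂ν)) atTop
      (𝓝 0) := by
    have h1 := (Real.continuous_sqrt.tendsto _).comp hg0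
    rw [Real.sqrt_zero] at h1
    simpa using ((h1.const_mul (√M)).add hg0).const_mul K1
  obtain ⟨n₀, hn₀⟩ := (Metric.tendsto_atTop.1 hlim) (ε / 2) (by positivity)
  refine ⟨n₀, fun n hn => ?_⟩
  have hsmall := hn₀ n hn
  rw [Real.dist_eq, sub_zero] at hsmall ⊢
  have pt : ∀ᵐ x ∂ν, ‖(U (α n • (G n x + g n x)) * ‖G n x + g n x‖ ^ 2 +
        L (G n x + g n x) (G n x + g n x) / 2) -
      (U (α n • G n x) * ‖G n x‖ ^ 2 + L (G n x) (G n x) / 2)‖ ≤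
      ε' * ‖G n x‖ ^ 2 + K1 * (‖G n x‖ * ‖g n x‖ + ‖g n x‖ ^ 2) := by
    filter_upwards [hGC n, hgC n] with x h1 h2
    generalize G n x = a at *
    generalize g n x = b at *
    have hC := le_abs_self C
    have hab : ‖α n • a + α n • b‖ ≤ 2 * |C| := (norm_add_le _ _).trans (by linarith)
    have hU1 := hK (α n • a) (α n • b) (by linarith [norm_nonneg (α n • a)]) hab
    have hU2 := hB (α n • a + α n • b) (by simpa using hab)
    rw [← smul_add] at hU1 hU2
    rw [Real.norm_eq_abs] at hU2
    have e1 : (U (α n • (a + b)) * ‖a + b‖ ^ 2 + L (a + b) (a + b) / 2) -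
        (U (α n • a) * ‖a‖ ^ 2 + L a a / 2) =
        (U (α n • (a + b)) - U (α n • a)) * ‖a‖ ^ 2 +
        U (α n • (a + b)) * (‖a + b‖ ^ 2 - ‖a‖ ^ 2) + (L a b + L b a + L b b) / 2 := by
      simp only [map_add, _root_.add_apply]; ring
    have b1 : |(U (α n • (a + b)) - U (α n • a)) * ‖a‖ ^ 2| ≤
        ε' * ‖a‖ ^ 2 + K * |C| * (‖a‖ * ‖b‖) := by
      rw [abs_mul, abs_of_nonneg (sq_nonneg ‖a‖)]
      -- The factor α is shifted from `b` to `a`, where αa is bounded by C; the cubic term thus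
      -- becomes a multiple of ‖a‖‖b‖, whose integral tends to zero.
      have h3 : ‖α n • b‖ * ‖a‖ = ‖α n • a‖ * ‖b‖ := by
        rw [norm_smul, norm_smul]; ring
      calc _ ≤ (ε' + K * ‖α n • b‖) * ‖a‖ ^ 2 := by gcongr
        _ = ε' * ‖a‖ ^ 2 + K * (‖α n • a‖ * ‖b‖) * ‖a‖ := by rw [← h3]; ring
        _ ≤ ε' * ‖a‖ ^ 2 + K * (|C| * ‖b‖) * ‖a‖ := by gcongr; linarith
        _ = _ := by ring
    have b2 : |U (α n • (a + b)) * (‖a + b‖ ^ 2 - ‖a‖ ^ 2)| ≤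
        |B| * (2 * (‖a‖ * ‖b‖) + ‖b‖ ^ 2) := by
      rw [abs_mul]
      refine mul_le_mul (hU2.trans (le_abs_self B)) ?_ (abs_nonneg _) (abs_nonneg _)
      rw [norm_add_sq_real]
      have := abs_real_inner_le_norm a b
      rw [abs_le] at this ⊢
      constructor <;> nlinarith [norm_nonneg b, sq_nonneg ‖b‖]
    have b3 : |(L a b + L b a + L b b) / 2| ≤ ‖L‖ * (‖a‖ * ‖b‖ + ‖b‖ ^ 2) := by
      have l1 := L.le_opNorm₂ a b
      have l2 := L.le_opNorm₂ b a
      have l3 := L.le_opNorm₂ b b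
      rw [Real.norm_eq_abs] at l1 l2 l3
      have h0 : 0 ≤ ‖L‖ * ‖b‖ ^ 2 := by positivity
      rw [abs_le] at *
      constructor <;> linarith
    rw [e1, Real.norm_eq_abs]
    have t1 := abs_add_le ((U (α n • (a + b)) - U (α n • a)) * ‖a‖ ^ 2 +
        U (α n • (a + b)) * (‖a + b‖ ^ 2 - ‖a‖ ^ 2)) ((L a b + L b a + L b b) / 2)
    have t2 := abs_add_le ((U (α n • (a + b)) - U (α n • a)) * ‖a‖ ^ 2)
        (U (α n • (a + b)) * (‖a + b‖ ^ 2 - ‖a‖ ^ 2))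
    have p1 : 0 ≤ K * |C| * ‖b‖ ^ 2 := by positivity
    have p2 : 0 ≤ |B| * ‖b‖ ^ 2 := by positivity
    have e2 : K1 * (‖a‖ * ‖b‖ + ‖b‖ ^ 2) = K * |C| * (‖a‖ * ‖b‖) + K * |C| * ‖b‖ ^ 2 +
        (|B| * (2 * (‖a‖ * ‖b‖) + ‖b‖ ^ 2) + |B| * ‖b‖ ^ 2) + ‖L‖ * (‖a‖ * ‖b‖ + ‖b‖ ^ 2) := by
      rw [hK1]; ring
    linarith
  have iG := (hG n).integrable_norm_pow (p := 2) (by norm_num)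
  have ig := (hg n).integrable_norm_pow (p := 2) (by norm_num)
  have iGg : Integrable (fun x => ‖G n x‖ * ‖g n x‖) ν := (hG n).norm.integrable_mul (hg n).norm
  have hcs := abs_integral_mul_le_sqrt (hG n).norm (hg n).norm
  have hint := norm_integral_le_of_norm_le
    ((iG.const_mul ε').add ((iGg.add ig).const_mul K1)) pt
  rw [Real.norm_eq_abs] at hint
  have hval : ∫ x, (ε' * ‖G n x‖ ^ 2 + K1 * (‖G n x‖ * ‖g n x‖ + ‖g n x‖ ^ 2)) ∂ν =
      ε' * ∫ x, ‖G n x‖ ^ 2 ∂ν + K1 * (∫ x, ‖G n x‖ * ‖g n x‖ ∂ν + ∫ x, ‖g n x‖ ^ 2 ∂ν) := by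
    have iS : Integrable (fun x => K1 * (‖G n x‖ * ‖g n x‖ + ‖g n x‖ ^ 2)) ν :=
      (iGg.add ig).const_mul K1
    rw [integral_add (iG.const_mul ε') iS, integral_const_mul, integral_const_mul,
      integral_add iGg ig]
  have hK1' : 0 ≤ K1 := by positivity
  refine lt_of_le_of_lt (hint.trans (le_of_eq hval)) ?_
  have a1 : ε' * ∫ x, ‖G n x‖ ^ 2 ∂ν < ε / 2 := by
    have : ε' * (|M| + 1) = ε / 2 := by rw [hε']; field_simp
    rw [← this]
    exact mul_lt_mul_of_pos_left (by linarith [hM n, le_abs_self M]) hε'0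
  have a2 : K1 * (∫ x, ‖G n x‖ * ‖g n x‖ ∂ν + ∫ x, ‖g n x‖ ^ 2 ∂ν) ≤
      K1 * (√M * √(∫ x, ‖g n x‖ ^ 2 ∂ν) + ∫ x, ‖g n x‖ ^ 2 ∂ν) := by
    gcongr
    refine ((le_abs_self _).trans hcs).trans ?_
    gcongr
    exact hM n
  linarith [le_abs_self (K1 * (√M * √(∫ x, ‖g n x‖ ^ 2 ∂ν) + ∫ x, ‖g n x‖ ^ 2 ∂ν))]

lemma integrable_energy {U : V → ℝ} (hU : Continuous U) {α C : ℝ} {H : X → V} (hH : MemLp H 2 ν)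
    (hHC : ∀ᵐ x ∂ν, ‖α • H x‖ ≤ C) : Integrable (fun x => U (α • H x) * ‖H x‖ ^ 2) ν := by
  obtain ⟨B, hB⟩ := (isCompact_closedBall (0 : V) C).exists_bound_of_continuousOn hU.continuousOn
  refine Integrable.bdd_mul (hH.integrable_norm_pow (p := 2) (by norm_num))
    (hU.comp_aestronglyMeasurable (hH.1.const_smul α)) (c := B) ?_
  filter_upwards [hHC] with x hx
  exact hB _ (by simpa using hx)

end Perturbation

/-! ### The limit in n for a fixed cut-off -/

section LimitN

variable {d m : ℕ} {Ω : Set (Vec d)} {F : Vec d → Mat m d} {W : Vec d → Mat m d → ℝ}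

lemma BoundedW1Inf.exists_ae_bound (hΩ : IsOpen Ω) {α : ℕ → ℝ} {v : ℕ → Vec d → Vec m}
    (hv : ∀ n, HasWeakGrad Ω (v n) (weakGrad Ω (v n)))
    (h : BoundedW1Inf Ω (fun n x => α n • v n x)) :
    ∃ C : ℝ≥0, (∀ n, ∀ᵐ x ∂(volume.restrict Ω), ‖α n • v n x‖ ≤ C) ∧
      (∀ n, ∀ᵐ x ∂(volume.restrict Ω), ‖α n • weakGrad Ω (v n) x‖ ≤ C) ∧
      gradBound Ω α v ≤ C := by
  obtain ⟨C, hC⟩ := h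
  have key : ∀ {V : Type} [NormedAddCommGroup V] {f : Vec d → V},
      eLpNorm f ⊤ (volume.restrict Ω) ≤ C → ∀ᵐ x ∂(volume.restrict Ω), ‖f x‖ ≤ C := by
    intro V _ f hf
    rw [eLpNorm_exponent_top] at hf
    filter_upwards [ae_le_eLpNormEssSup (f := f) (μ := volume.restrict Ω)] with x hx
    have := hx.trans hf
    rw [enorm_le_coe] at this
    exact_mod_cast this
  have hsm : ∀ n, eLpNorm (fun x => α n • weakGrad Ω (v n) x) ⊤ (volume.restrict Ω) ≤ C := by
    intro n
    refine le_of_eq_of_le (eLpNorm_congr_ae ?_) (hC n).2.2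
    exact (((hv n).const_smul hΩ (α n)).weakGrad_ae_eq hΩ).symm
  exact ⟨C, fun n => key (hC n).2.1, fun n => key (hsm n), iSup_le hsm⟩

lemma setIntegral_scriptF_eq (hΩ : IsC1Domain Ω) {x₀ : Vec d} {r a : ℝ} {θ : Vec d → ℝ}
    (hθ : ContDiff ℝ ∞ θ)
    (hs : ∃ K : Set (Vec d), IsCompact K ∧ K ⊆ ballIn Ω x₀ r ∧ ∀ x ∈ closure Ω, x ∉ K → θ x = 0)
    {u : Vec d → Vec m} {G : Vec d → Mat m d} (hu : HasWeakGrad Ω u G) :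
    ∫ x in ballIn Ω x₀ r, scriptF W F x₀ a (weakGrad Ω (fun z => θ z • u z) x)
        ∂(volume.restrict Ω) =
      ∫ x in Ω, scriptF W F x₀ a (θ x • G x + outer (u x) (gradVec θ x)) := by
  obtain ⟨K, hK, hKB, hK0⟩ := hs
  have hBm : MeasurableSet (ballIn Ω x₀ r) :=
    Metric.isOpen_ball.measurableSet.inter isClosed_closure.measurableSet
  rw [← integral_indicator hBm]
  refine integral_congr_ae ?_
  filter_upwards [(hu.smooth_smul hΩ.isOpen hθ).weakGrad_ae_eq hΩ.isOpen,
    ae_restrict_mem hΩ.isOpen.measurableSet] with x hx hxΩ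
  by_cases hxB : x ∈ ballIn Ω x₀ r
  · rw [indicator_of_mem hxB, hx]
  · rw [indicator_of_notMem hxB]
    -- The set Ω \ K is open, so θ vanishes near `x` and its gradient vanishes at `x` too; the
    -- integrand is zero off the ball.
    have hnb : θ =ᶠ[𝓝 x] fun _ => 0 := by
      filter_upwards [(hΩ.isOpen.sdiff hK.isClosed).mem_nhds ⟨hxΩ, fun h => hxB (hKB h)⟩] with y hy
      exact hK0 y (subset_closure hy.1) hy.2
    have h1 : gradVec θ x = 0 := by
      ext j
      simp [gradVec, hnb.fderiv_eq]
    have h2 : outer (u x) (0 : Vec d) = 0 := by ext p; simp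
    rw [hnb.eq_of_nhds, h1, h2]
    simp

/-- The limit in `n` for a fixed cut-off function. -/
lemma tendsto_setIntegral_scriptF (hΩ : IsC1Domain Ω) (hW : IsLagrangian Ω F W)
    {α : ℕ → ℝ} (hα : ∀ n, 0 < α n) {v : ℕ → Vec d → Vec m} (hv : WeaklyNullW12 Ω v)
    (hαv : BoundedW1Inf Ω (fun n x => α n • v n x))
    {π : Measure (Vec d)} {μ lam : Kernel (Vec d) (Mat m d)}
    (hlim : IsLimitMeasures Ω α v π μ lam) {x₀ : Vec d} (hx₀ : x₀ ∈ closure Ω) {r : ℝ}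
    {θ : Vec d → ℝ} (hθ : ContDiff ℝ ∞ θ)
    (hs : ∃ K : Set (Vec d), IsCompact K ∧ K ⊆ ballIn Ω x₀ r ∧
      ∀ x ∈ closure Ω, x ∉ K → θ x = 0) :
    Tendsto (fun n => ∫ x in ballIn Ω x₀ r,
        scriptF W F x₀ (α n) (weakGrad Ω (fun z => θ z • v n z) x) ∂(volume.restrict Ω)) atTop
      (𝓝 ((∫ p, θ p.1 ^ 2 * Ufun W F x₀ (θ p.1 • p.2) ∂(π ⊗ₘ μ)) +
        1 / 2 * ∫ p, θ p.1 ^ 2 * quadL W F x₀ p.2 ∂(π ⊗ₘ lam))) := by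
  have hG := fun n => (hv.1 n).weakGrad_spec hΩ.isOpen
  have hv2 : ∀ n, MemLp (v n) 2 (volume.restrict Ω) := fun n => (hv.1 n).1
  have hU := hW.continuous_Ufun hx₀
  set L := fderiv ℝ (fderiv ℝ (W x₀)) (F x₀) with hL
  obtain ⟨C, hC1, hC2, -⟩ := hαv.exists_ae_bound hΩ.isOpen (fun n => (hG n).1)
  have hcomp : IsCompact (closure Ω) := hΩ.isBounded.isCompact_closure
  obtain ⟨a, ha⟩ := hcomp.exists_bound_of_continuousOn hθ.continuous.continuousOn
  obtain ⟨b, hb⟩ := hcomp.exists_bound_of_continuousOn (continuous_gradVec hθ).continuousOn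
  have haΩ : ∀ᵐ x ∂(volume.restrict Ω), ‖θ x‖ ≤ |a| ∧ ‖gradVec θ x‖ ≤ |b| := by
    filter_upwards [ae_restrict_mem hΩ.isOpen.measurableSet] with x hx
    exact ⟨(ha x (subset_closure hx)).trans (le_abs_self a),
      (hb x (subset_closure hx)).trans (le_abs_self b)⟩
  set G : ℕ → Vec d → Mat m d := fun n x => θ x • weakGrad Ω (v n) x with hGdef
  set g : ℕ → Vec d → Mat m d := fun n x => outer (v n x) (gradVec θ x) with hgdef
  have hGm : ∀ n, MemLp (G n) 2 (volume.restrict Ω) := fun n =>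
    (hG n).2.of_le_mul (c := |a|)
      (hθ.continuous.aestronglyMeasurable.smul (hG n).2.1) (by
        filter_upwards [haΩ] with x hx
        rw [hGdef, norm_smul]
        gcongr
        exact hx.1)
  have hgm : ∀ n, MemLp (g n) 2 (volume.restrict Ω) := fun n =>
    (hv2 n).of_le_mul (c := |b|)
      (continuous_outer.comp_aestronglyMeasurable
        ((hv2 n).1.prodMk (continuous_gradVec hθ).aestronglyMeasurable)) (by
        filter_upwards [haΩ] with x hx
        rw [hgdef, norm_outer, mul_comm]
        gcongr
        exact hx.2)
  have hGC : ∀ n, ∀ᵐ x ∂(volume.restrict Ω), ‖α n • G n x‖ ≤ (|a| + |b|) * C := fun n => by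
    filter_upwards [haΩ, hC2 n] with x hx hx2
    have : ‖α n • G n x‖ = ‖θ x‖ * ‖α n • weakGrad Ω (v n) x‖ := by
      simp only [hGdef, norm_smul]; ring
    rw [this]
    gcongr
    linarith [hx.1, abs_nonneg b]
  have hgC : ∀ n, ∀ᵐ x ∂(volume.restrict Ω), ‖α n • g n x‖ ≤ (|a| + |b|) * C := fun n => by
    filter_upwards [haΩ, hC1 n] with x hx hx2
    have : ‖α n • g n x‖ = ‖gradVec θ x‖ * ‖α n • v n x‖ := by
      simp only [hgdef, norm_smul, norm_outer]; ring
    rw [this]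
    gcongr
    linarith [hx.2, abs_nonneg a]
  have hg0 : Tendsto (fun n => ∫ x in Ω, ‖g n x‖ ^ 2) atTop (𝓝 0) := by
    have h0 := (hv.tendsto_integral_norm_sq hΩ).const_mul (|b| ^ 2)
    rw [mul_zero] at h0
    refine squeeze_zero (fun n => integral_nonneg fun x => by positivity) (fun n => ?_) h0
    rw [← integral_const_mul]
    refine integral_mono_ae ((hgm n).integrable_norm_pow (by norm_num))
      (((hv2 n).integrable_norm_pow (by norm_num)).const_mul _) ?_
    filter_upwards [haΩ] with x hx
    simp only [hgdef, norm_outer]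
    rw [← mul_pow, mul_comm]
    gcongr
    exact hx.2
  have hM : ∃ M, ∀ n, ∫ x in Ω, ‖G n x‖ ^ 2 ≤ M := by
    obtain ⟨M, hM⟩ := exists_integral_norm_sq_le (fun n => (hG n).2) (fun g hg => by
      simpa using hv.2 0 g MemLp.zero hg)
    refine ⟨|a| ^ 2 * M, fun n => ?_⟩
    refine le_trans ?_ (mul_le_mul_of_nonneg_left (hM n) (by positivity))
    rw [← integral_const_mul]
    refine integral_mono_ae ((hGm n).integrable_norm_pow (by norm_num))
      (((hG n).2.integrable_norm_pow (by norm_num)).const_mul _) ?_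
    filter_upwards [haΩ] with x hx
    simp only [hGdef, norm_smul]
    rw [← mul_pow]
    gcongr
    exact hx.1
  obtain ⟨M, hM⟩ := hM
  -- Since `g n` → 0 in L², only the gradients θ ∇v_n contribute to the limit.
  have hdiff := tendsto_integral_energy_sub hU L hGm hgm hM hg0 hGC hgC
  have hmain : Tendsto (fun n => ∫ x in Ω, (Ufun W F x₀ (α n • G n x) * ‖G n x‖ ^ 2 +
      L (G n x) (G n x) / 2)) atTop
      (𝓝 ((∫ p, θ p.1 ^ 2 * Ufun W F x₀ (θ p.1 • p.2) ∂(π ⊗ₘ μ)) +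
        1 / 2 * ∫ p, θ p.1 ^ 2 * quadL W F x₀ p.2 ∂(π ⊗ₘ lam))) := by
    have hθc := hθ.continuous
    have hQ : Continuous (quadL W F x₀) := by unfold quadL; fun_prop
    -- The cut-off is absorbed into the test functions: |θ∇v|² = θ²|∇v|² and αθ∇v = θ(α∇v).
    have h1 := hlim.tendsto_mu (fun p => θ p.1 ^ 2 * Ufun W F x₀ (θ p.1 • p.2))
      (by fun_prop : Continuous _).continuousOn
    have h2 := hlim.tendsto_lam (fun p => θ p.1 ^ 2 * quadL W F x₀ p.2)
      (by fun_prop : Continuous _).continuousOn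
    refine (h1.add (h2.const_mul (1 / 2))).congr fun n => ?_
    rw [integral_add (integrable_energy hU (hGm n) (hGC n))
      ((integrable_bilinear L (hGm n)).div_const 2)]
    congr 1
    · congr 1; ext x
      simp only [hGdef]
      rw [norm_smul, mul_pow, smul_comm (α n) (θ x), Real.norm_eq_abs, sq_abs]
      ring
    · rw [← integral_const_mul]
      congr 1; ext x
      simp only [hGdef, quadL, ← hL, map_smul, smul_apply, smul_eq_mul]
      -- The quadratic form is 2-homogeneous, so normalizing ∇v and multiplying by |∇v|² changes
      -- nothing; where ∇v = 0 both sides vanish.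
      by_cases h0 : weakGrad Ω (v n) x = 0
      · simp [h0]
      · have : ‖weakGrad Ω (v n) x‖ ≠ 0 := by simpa using h0
        field_simp
  have hfull := hdiff.add hmain
  rw [zero_add] at hfull
  refine hfull.congr fun n => ?_
  have hHm : MemLp (fun x => G n x + g n x) 2 (volume.restrict Ω) := (hGm n).add (hgm n)
  have hHC : ∀ᵐ x ∂(volume.restrict Ω), ‖α n • (G n x + g n x)‖ ≤ 2 * ((|a| + |b|) * C) := by
    filter_upwards [hGC n, hgC n] with x h1 h2
    rw [smul_add]
    exact (norm_add_le _ _).trans (by linarith)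
  have i1 : Integrable (fun x => Ufun W F x₀ (α n • (G n x + g n x)) * ‖G n x + g n x‖ ^ 2 +
      L (G n x + g n x) (G n x + g n x) / 2) (volume.restrict Ω) :=
    (integrable_energy hU hHm hHC).add ((integrable_bilinear L hHm).div_const 2)
  have i2 : Integrable (fun x => Ufun W F x₀ (α n • G n x) * ‖G n x‖ ^ 2 +
      L (G n x) (G n x) / 2) (volume.restrict Ω) :=
    (integrable_energy hU (hGm n) (hGC n)).add ((integrable_bilinear L (hGm n)).div_const 2)
  rw [setIntegral_scriptF_eq hΩ hθ hs (hG n).1, integral_sub i1 i2, sub_add_cancel]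
  congr 1; ext x
  rw [scriptF_eq (hα n)]
  rfl

end LimitN

/-! ### The limit in k of the cut-offs -/

section LimitK

variable {d : ℕ} {V : Type*} [NormedAddCommGroup V] [InnerProductSpace ℝ V] [FiniteDimensional ℝ V]
  [MeasurableSpace V] [BorelSpace V]

/-- The limit in `k` of the weighted integrals, by dominated convergence. -/
lemma tendsto_integral_cutoff {Ω : Set (Vec d)} {x₀ : Vec d} {r : ℝ} {θ : ℕ → Vec d → ℝ}
    (hθ : IsCutoffSeq Ω x₀ r θ) {π : Measure (Vec d)} [IsFiniteMeasure π]
    (hπ : π (closure Ω)ᶜ = 0) {κ : Kernel (Vec d) V} [IsMarkovKernel κ] {R : ℝ}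
    (hκ : ∀ᵐ x ∂π, ∀ᵐ H ∂κ x, ‖H‖ ≤ R) {f : ℝ × V → ℝ} (hf : Continuous f)
    (hf0 : ∀ H, f (0, H) = 0) :
    Tendsto (fun k => ∫ p, f (θ k p.1, p.2) ∂(π ⊗ₘ κ)) atTop
      (𝓝 (∫ x in ballIn Ω x₀ r, ∫ H, f (1, H) ∂(κ x) ∂π)) := by
  have hBm : MeasurableSet (ballIn Ω x₀ r) :=
    Metric.isOpen_ball.measurableSet.inter isClosed_closure.measurableSet
  -- The measure lives where θ_k and H are bounded, so `f` is evaluated on a fixed compact set and a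
  -- constant dominates.
  have hae : ∀ᵐ p ∂(π ⊗ₘ κ), p.1 ∈ closure Ω ∧ ‖p.2‖ ≤ R := by
    refine Measure.ae_compProd_of_ae_ae ?_ ?_
    · exact (measurable_fst isClosed_closure.measurableSet).inter
        (measurableSet_le measurable_snd.norm measurable_const)
    · have : ∀ᵐ x ∂π, x ∈ closure Ω := hπ
      filter_upwards [this, hκ] with x h1 h2
      filter_upwards [h2] with H h3 using ⟨h1, h3⟩
  obtain ⟨C, hC⟩ := hθ.bounded
  obtain ⟨B, hB⟩ := ((isCompact_closedBall (0 : ℝ) C).prod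
    (isCompact_closedBall (0 : V) R)).exists_bound_of_continuousOn hf.continuousOn
  have hdct := tendsto_integral_of_dominated_convergence (μ := π ⊗ₘ κ)
    (F := fun k p => f (θ k p.1, p.2)) (f := fun p => f ((ballIn Ω x₀ r).indicator 1 p.1, p.2))
    (fun _ => B) (fun k => by
      have := (hθ.smooth k).continuous
      exact (by fun_prop : Continuous fun p : Vec d × V => f (θ k p.1, p.2)).aestronglyMeasurable)
    (integrable_const B) (fun k => by
      filter_upwards [hae] with p hp
      exact hB _ ⟨by simpa using hC k _ hp.1, by simpa using hp.2⟩) (by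
      filter_upwards [hae] with p hp
      exact (hf.tendsto _).comp ((hθ.tendsto p.1 hp.1).prodMk_nhds tendsto_const_nhds))
  have hind : ∀ p : Vec d × V, f ((ballIn Ω x₀ r).indicator 1 p.1, p.2) =
      (ballIn Ω x₀ r ×ˢ univ).indicator (fun p => f (1, p.2)) p := by
    intro p
    by_cases hp : p.1 ∈ ballIn Ω x₀ r <;> simp [hp, hf0]
  simp_rw [hind] at hdct
  rw [integral_indicator (hBm.prod MeasurableSet.univ), Measure.setIntegral_compProd hBm
    MeasurableSet.univ] at hdct
  · simpa using hdct
  · refine Integrable.integrableOn ?_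
    obtain ⟨B', hB'⟩ := (isCompact_closedBall (0 : V) R).exists_bound_of_continuousOn
      (by fun_prop : Continuous fun H => f (1, H)).continuousOn
    refine Integrable.of_bound (C := B') (by
      exact (by fun_prop : Continuous fun p : Vec d × V => f (1, p.2)).aestronglyMeasurable) ?_
    filter_upwards [hae] with p hp
    exact hB' _ (by simpa using hp.2)

end LimitK

/-! ### Lebesgue points common to all continuous integrands -/

section LimitR

variable {d : ℕ}

/-- The Lebesgue differentiation theorem with open balls. -/
lemma ae_tendsto_average_ball {π : Measure (Vec d)} [IsFiniteMeasure π] {f : Vec d → ℝ}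
    (hf : Integrable f π) :
    ∀ᵐ x₀ ∂π, Tendsto (fun r => ⨍ x in Metric.ball x₀ r, f x ∂π) (𝓝[>] 0) (𝓝 (f x₀)) := by
  have hsupp : ∀ᵐ x ∂π, x ∈ π.support := Measure.support_mem_ae
  filter_upwards [(Besicovitch.vitaliFamily π).ae_tendsto_average hf.locallyIntegrable, hsupp]
    with x₀ hx hxs
  have hcl := hx.comp (Besicovitch.tendsto_filterAt π x₀)
  have hpos : ∀ r : ℝ, 0 < r → 0 < π (Metric.ball x₀ r) := fun r hr =>
    (Measure.mem_support_iff_forall x₀).1 hxs _ (Metric.ball_mem_nhds x₀ hr)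
  rw [Metric.tendsto_nhdsWithin_nhds] at hcl ⊢
  intro ε hε
  obtain ⟨δ, hδ, hδ'⟩ := hcl (ε / 2) (by positivity)
  refine ⟨δ, hδ, fun {r} hr hrδ => ?_⟩
  have hr0 : 0 < r := hr
  rw [Real.dist_eq, sub_zero, abs_of_pos hr0] at hrδ
  -- The Besicovitch theorem concerns closed balls. Radii increasing strictly below `r` exhaust the
  -- open ball; the shift by 2 keeps them positive.
  set s : ℕ → ℝ := fun j => r - r / (j + 2) with hs
  have hs0 : ∀ j, 0 < s j := fun j => by
    have : r / (j + 2) < r := div_lt_self hr0 (by have : (0 : ℝ) ≤ j := j.cast_nonneg; linarith)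
    simp only [hs]; linarith
  have hsr : ∀ j, s j < r := fun j => by
    have : 0 < r / ((j : ℝ) + 2) := by positivity
    simp only [hs]; linarith
  have hmono : Monotone fun j => Metric.closedBall x₀ (s j) := fun i j hij =>
    Metric.closedBall_subset_closedBall (by
      have : (i : ℝ) ≤ j := by exact_mod_cast hij
      simp only [hs]
      gcongr)
  have hunion : ⋃ j, Metric.closedBall x₀ (s j) = Metric.ball x₀ r := by
    ext x
    simp only [mem_iUnion, Metric.mem_closedBall, Metric.mem_ball]
    constructor
    · rintro ⟨j, hj⟩
      exact hj.trans_lt (hsr j)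
    · intro hxr
      have hlim : Tendsto s atTop (𝓝 r) := by
        have h1 : Tendsto (fun j : ℕ => r / ((j : ℝ) + 2)) atTop (𝓝 0) :=
          Tendsto.const_div_atTop (tendsto_atTop_add_const_right _ _ tendsto_natCast_atTop_atTop) r
        simpa using h1.const_sub r
      obtain ⟨j, hj⟩ := (hlim.eventually (lt_mem_nhds hxr)).exists
      exact ⟨j, hj.le⟩
  have hint : Tendsto (fun j => ∫ x in Metric.closedBall x₀ (s j), f x ∂π) atTop
      (𝓝 (∫ x in Metric.ball x₀ r, f x ∂π)) := by
    rw [← hunion]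
    exact tendsto_setIntegral_of_monotone (fun j => Metric.isClosed_closedBall.measurableSet) hmono
      hf.integrableOn
  have hmeas : Tendsto (fun j => π.real (Metric.closedBall x₀ (s j))) atTop
      (𝓝 (π.real (Metric.ball x₀ r))) := by
    rw [← hunion]
    exact (ENNReal.tendsto_toReal (measure_ne_top _ _)).comp (tendsto_measure_iUnion_atTop hmono)
  have hne : π.real (Metric.ball x₀ r) ≠ 0 :=
    (ENNReal.toReal_pos (hpos r hr0).ne' (measure_ne_top _ _)).ne'
  have hav : Tendsto (fun j => ⨍ x in Metric.closedBall x₀ (s j), f x ∂π) atTop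
      (𝓝 (⨍ x in Metric.ball x₀ r, f x ∂π)) := by
    simp_rw [setAverage_eq]
    exact (hmeas.inv₀ hne).smul hint
  have hle : dist (⨍ x in Metric.ball x₀ r, f x ∂π) (f x₀) ≤ ε / 2 := by
    refine le_of_tendsto (hav.dist tendsto_const_nhds) (Eventually.of_forall fun j => ?_)
    refine (hδ' (x := s j) (hs0 j) ?_).le
    rw [Real.dist_eq, sub_zero, abs_of_pos (hs0 j)]
    exact (hsr j).trans hrδ
  linarith

variable {V : Type*} [NormedAddCommGroup V] [InnerProductSpace ℝ V] [FiniteDimensional ℝ V]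

/-- C(V, ℝ) is separable in the compact-open topology, and restriction to `K` is continuous into the
uniform norm. -/
lemma exists_seq_dense_on_compact {K : Set V} (hK : IsCompact K) :
    ∃ g : ℕ → C(V, ℝ), ∀ f : C(V, ℝ), ∀ ε > 0, ∃ n, ∀ H ∈ K, |f H - g n H| < ε := by
  refine ⟨TopologicalSpace.denseSeq C(V, ℝ), fun f ε hε => ?_⟩
  have hKc : CompactSpace K := isCompact_iff_compactSpace.1 hK
  have hopen : IsOpen {h : C(V, ℝ) | dist (f.restrict K) (h.restrict K) < ε} :=
    isOpen_lt (continuous_const.dist (ContinuousMap.continuous_restrict K)) continuous_const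
  obtain ⟨n, hn⟩ := (TopologicalSpace.denseRange_denseSeq C(V, ℝ)).exists_mem_open hopen
    ⟨f, by simpa using hε⟩
  refine ⟨n, fun H hH => ?_⟩
  have := (ContinuousMap.dist_lt_iff hε).1 hn ⟨H, hH⟩
  rwa [Real.dist_eq] at this

variable [MeasurableSpace V] [BorelSpace V]

/-- Almost every point is a Lebesgue point of the integrals of all continuous functions against a
kernel carried by a ball, with one exceptional set for all integrands. -/
lemma ae_forall_tendsto_average_kernel {Ω : Set (Vec d)} {π : Measure (Vec d)} [IsFiniteMeasure π]
    (hπ : π (closure Ω)ᶜ = 0) {κ : Kernel (Vec d) V} [IsMarkovKernel κ] {R : ℝ}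
    (hκ : ∀ᵐ x ∂π, ∀ᵐ H ∂κ x, ‖H‖ ≤ R) :
    ∀ᵐ x₀ ∂π, (∀ r, 0 < r → 0 < π (ballIn Ω x₀ r)) ∧ ∀ f : V → ℝ, Continuous f →
      Tendsto (fun r => ⨍ x in ballIn Ω x₀ r, (∫ H, f H ∂κ x) ∂π) (𝓝[>] 0)
        (𝓝 (∫ H, f H ∂κ x₀)) := by
  have hball : ∀ x₀ r, (ballIn Ω x₀ r : Set (Vec d)) =ᵐ[π] Metric.ball x₀ r := fun x₀ r =>
    inter_ae_eq_left_of_ae_eq_univ (ae_eq_univ.2 hπ)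
  have hK := isCompact_closedBall (0 : V) R
  have hi : ∀ {f : V → ℝ}, Continuous f → ∀ x, (∀ᵐ H ∂κ x, ‖H‖ ≤ R) → Integrable f (κ x) := by
    intro f hf x hx
    obtain ⟨B, hB⟩ := hK.exists_bound_of_continuousOn hf.continuousOn
    refine Integrable.of_bound hf.aestronglyMeasurable B ?_
    filter_upwards [hx] with H hH using hB _ (by simpa using hH)
  have hI : ∀ {f : V → ℝ}, Continuous f → Integrable (fun x => ∫ H, f H ∂κ x) π := by
    intro f hf
    obtain ⟨B, hB⟩ := hK.exists_bound_of_continuousOn hf.continuousOn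
    refine Integrable.of_bound (C := B) ?_ ?_
    · exact (hf.stronglyMeasurable.integral_kernel (κ := κ)).aestronglyMeasurable
    · filter_upwards [hκ] with x hx
      have := norm_integral_le_of_norm_le_const (μ := κ x) (f := f) (C := B) (by
        filter_upwards [hx] with H hH using hB _ (by simpa using hH))
      simpa using this
  obtain ⟨g, hg⟩ := exists_seq_dense_on_compact hK
  -- Only countably many null sets are discarded, one for each member of the dense sequence.
  have hall := ae_all_iff.2 fun n => ae_tendsto_average_ball (hI (g n).continuous)
  have hsupp : ∀ᵐ x ∂π, x ∈ π.support := Measure.support_mem_ae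
  filter_upwards [hall, hsupp, hκ] with x₀ hx₀ hxs hκ₀
  have hpos : ∀ r, 0 < r → 0 < π (ballIn Ω x₀ r) := fun r hr => by
    rw [measure_congr (hball x₀ r)]
    exact (Measure.mem_support_iff_forall x₀).1 hxs _ (Metric.ball_mem_nhds x₀ hr)
  refine ⟨hpos, fun f hf => ?_⟩
  rw [Metric.tendsto_nhds]
  intro ε hε
  obtain ⟨n, hn⟩ := hg ⟨f, hf⟩ (ε / 4) (by positivity)
  have happ : ∀ x, (∀ᵐ H ∂κ x, ‖H‖ ≤ R) →
      |(∫ H, f H ∂κ x) - ∫ H, g n H ∂κ x| ≤ ε / 4 := by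
    intro x hx
    rw [← integral_sub (hi hf x hx) (hi (g n).continuous x hx)]
    have := norm_integral_le_of_norm_le_const (μ := κ x) (f := fun H => f H - g n H)
      (C := ε / 4) (by
        filter_upwards [hx] with H hH using (hn H (by simpa using hH)).le)
    simpa using this
  filter_upwards [Metric.tendsto_nhds.1 (hx₀ n) (ε / 4) (by positivity), self_mem_nhdsWithin]
    with r hr hr0
  have hr0' : (0 : ℝ) < r := hr0
  have hb : (⨍ x in Metric.ball x₀ r, (∫ H, g n H ∂κ x) ∂π) =
      ⨍ x in ballIn Ω x₀ r, (∫ H, g n H ∂κ x) ∂π := by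
    rw [Measure.restrict_congr_set (hball x₀ r)]
  rw [hb] at hr
  -- Averaging is integration against a probability measure, so it does not enlarge the uniform
  -- error ε/4.
  have hprob : IsProbabilityMeasure ((π (ballIn Ω x₀ r))⁻¹ • π.restrict (ballIn Ω x₀ r)) :=
    ⟨by
      rw [Measure.smul_apply, Measure.restrict_apply_univ, smul_eq_mul]
      exact ENNReal.inv_mul_cancel (hpos r hr0').ne' (measure_ne_top _ _)⟩
  have hdiff : |(⨍ x in ballIn Ω x₀ r, (∫ H, f H ∂κ x) ∂π) -
      ⨍ x in ballIn Ω x₀ r, (∫ H, g n H ∂κ x) ∂π| ≤ ε / 4 := by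
    rw [setAverage_eq', setAverage_eq']
    have hsm : ∀ {h : V → ℝ}, Continuous h → Integrable (fun x => ∫ H, h H ∂κ x)
        ((π (ballIn Ω x₀ r))⁻¹ • π.restrict (ballIn Ω x₀ r)) := fun hh =>
      (hI hh).restrict.smul_measure (ENNReal.inv_ne_top.2 (hpos r hr0').ne')
    rw [← integral_sub (hsm hf) (hsm (g n).continuous)]
    have := norm_integral_le_of_norm_le_const
      (μ := (π (ballIn Ω x₀ r))⁻¹ • π.restrict (ballIn Ω x₀ r))
      (f := fun x => (∫ H, f H ∂κ x) - ∫ H, g n H ∂κ x) (C := ε / 4)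
      (Measure.ae_smul_measure (ae_restrict_of_ae (hκ.mono happ)) _)
    simpa using this
  rw [Real.dist_eq] at hr ⊢
  have h3 := happ x₀ hκ₀
  rw [abs_lt] at *
  rw [abs_le] at hdiff h3
  constructor <;> linarith [hdiff.1, hdiff.2, h3.1, h3.2, hr.1, hr.2]

end LimitR

end

/-! ### The localization principle -/

theorem theorem8p1 {d m : ℕ} (Ω Γ₁ : Set (Vec d)) (hΩ : IsC1Domain Ω)
    (hΓ₁ : IsRelOpenInBoundary Ω Γ₁)
    (y : Vec d → Vec m) (F : Vec d → Mat m d) (hy : IsC1WithGrad Ω y F)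
    (W : Vec d → Mat m d → ℝ) (hW : IsLagrangian Ω F W)
    (α : ℕ → ℝ) (hα : ∀ n, 0 < α n)
    (v : ℕ → Vec d → Vec m) (hv : WeaklyNullW12 Ω v)
    (hαv : BoundedW1Inf Ω (fun n x => α n • v n x))
    (π : Measure (Vec d)) (μ lam : Kernel (Vec d) (Mat m d))
    (hlim : IsLimitMeasures Ω α v π μ lam) :
    ∀ᵐ x₀ ∂π, x₀ ∈ Ω ∪ closure Γ₁ →
      ∀ θ : ℝ → ℕ → Vec d → ℝ, (∀ r, 0 < r → IsCutoffSeq Ω x₀ r (θ r)) →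
        ∃ (A : ℝ → ℕ → ℝ) (B : ℝ → ℝ),
          (∀ r, 0 < r → 0 < π (ballIn Ω x₀ r)) ∧
          (∀ r, 0 < r → ∀ k, Tendsto
            (fun n => localAverage Ω W F π x₀ r (θ r k) (α n) (v n)) atTop (𝓝 (A r k))) ∧
          (∀ r, 0 < r → Tendsto (fun k => A r k) atTop (𝓝 (B r))) ∧
          Tendsto B (𝓝[>] 0) (𝓝 (scriptI W F x₀ (μ x₀) (lam x₀))) := by
  have := hlim.finite
  have := hlim.markov_mu
  have := hlim.markov_lam
  obtain ⟨C, -, -, hC⟩ := hαv.exists_ae_bound hΩ.isOpen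
    (fun n => ((hv.1 n).weakGrad_spec hΩ.isOpen).1)
  have hμ : ∀ᵐ x ∂π, ∀ᵐ H ∂μ x, ‖H‖ ≤ C := by
    filter_upwards [hlim.carrier_mu] with x hx
    refine measure_mono_null (fun H hH => ?_) hx
    have hH' : ¬ ‖H‖ ≤ C := hH
    refine hC.trans_lt ?_
    rw [← not_le, enorm_le_coe]
    exact_mod_cast hH'
  have hlam : ∀ᵐ x ∂π, ∀ᵐ H ∂lam x, ‖H‖ ≤ 1 := by
    filter_upwards [hlim.carrier_lam] with x hx
    have hx' : ∀ᵐ H ∂lam x, H ∈ Metric.sphere (0 : Mat m d) 1 := hx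
    filter_upwards [hx'] with H hH using (mem_sphere_zero_iff_norm.1 hH).le
  have hclos : ∀ᵐ x ∂π, x ∈ closure Ω := hlim.carrier
  filter_upwards [ae_forall_tendsto_average_kernel hlim.carrier hμ,
    ae_forall_tendsto_average_kernel hlim.carrier hlam, hclos] with x₀ ⟨hpos, hμ₀⟩ ⟨_, hlam₀⟩ hx₀
  intro _ θ hθ
  have hU := hW.continuous_Ufun hx₀
  have hQ : Continuous (quadL W F x₀) := by unfold quadL; fun_prop
  -- `A` is the limit in n for the cut-off θ_k^r; `B` is the same expression with the cut-off
  -- replaced by the indicator of the ball, written as π-averages.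
  refine ⟨fun r k => 1 / (π (ballIn Ω x₀ r)).toReal *
      ((∫ p, θ r k p.1 ^ 2 * Ufun W F x₀ (θ r k p.1 • p.2) ∂(π ⊗ₘ μ)) +
        1 / 2 * ∫ p, θ r k p.1 ^ 2 * quadL W F x₀ p.2 ∂(π ⊗ₘ lam)),
    fun r => (⨍ x in ballIn Ω x₀ r, (∫ H, Ufun W F x₀ H ∂μ x) ∂π) +
      1 / 2 * ⨍ x in ballIn Ω x₀ r, (∫ H, quadL W F x₀ H ∂lam x) ∂π, hpos, ?_, ?_, ?_⟩
  · intro r hr k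
    exact (tendsto_setIntegral_scriptF hΩ hW hα hv hαv hlim hx₀ ((hθ r hr).smooth k)
      ((hθ r hr).support k)).const_mul _
  · intro r hr
    have h1 := tendsto_integral_cutoff (hθ r hr) hlim.carrier hμ
      (f := fun p => p.1 ^ 2 * Ufun W F x₀ (p.1 • p.2)) (by fun_prop) (by simp)
    have h2 := tendsto_integral_cutoff (hθ r hr) hlim.carrier hlam
      (f := fun p => p.1 ^ 2 * quadL W F x₀ p.2) (by fun_prop) (by simp)
    simp only [one_pow, one_mul, one_smul] at h1 h2
    have h3 := (h1.add (h2.const_mul (1 / 2))).const_mul (1 / (π (ballIn Ω x₀ r)).toReal)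
    convert h3 using 2
    simp only [setAverage_eq, smul_eq_mul, measureReal_def]
    ring
  -- The integrands are frozen at x₀, the very point of differentiation; this is allowed because x₀
  -- is a Lebesgue point for every continuous integrand.
  · exact (hμ₀ _ hU).add ((hlam₀ _ hQ).const_mul (1 / 2))
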